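/- Let $k\ge 1$, let $\boldsymbol n=(n_1,\dots,n_k)$ be positive integers, and put $n=n_1+\dots+n_k$. Write $z\in\mathbb C^n=\mathbb C^{n_1}\times\cdots\times\mathbb C^{n_k}$ as $z=(z_{(1)},\dots,z_{(k)})$, and let $d\lambda_n(z)=\pi^{-n}e^{-|z|^2}\,dz$ be the Gaussian measure. Let $\mathcal F(\mathbb C^n)$ be the Fock space of all entire functions on $\mathbb C^n$ that are square integrable with respect to $\lambda_n$, with reproducing kernel $K_z(w)=e^{\langle w,z\rangle}$, $\langle w,z\rangle=\sum_j w_j\bar z_j$. For $\varphi\in L^\infty(\mathbb C^n)$ let $T_\varphi:\mathcal F(\mathbb C^n)\to\mathcal F(\mathbb C^n)$ be the Toeplitz operator $$T_\varphi f(z)=\int_{\mathbb C^n}\varphi(w)f(w)\overline{K_z(w)}\,d\lambda_n(w).$$ For $\boldsymbol m=(m_1,\dots,m_k)\in\mathbb N_0^k$ let $P^{m_1}(\mathbb C^{n_1})\otimes\cdots\otimes P^{m_k}(\mathbb C^{n_k})$ be the span of all functions $z\mapsto\prod_{i=1}^k p_i(z_{(i)})$, where $p_i$ is a homogeneous polynomial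 of degree $m_i$ on $\mathbb C^{n_i}$. **Theorem.** Let $\varphi:\mathbb C^n\to\mathbb C$ be measurable, essentially bounded and invariant under $G=U_{n_1}\times\cdots\times U_{n_k}$, that is, $\varphi(A_1^{-1}z_{(1)},\dots,A_k^{-1}z_{(k)})=\varphi(z)$ for all $(A_1,\dots,A_k)\in G$ and all $z\in\mathbb C^n$. Then there is a function $a$ with $$\varphi(z)=a(|z_{(1)}|,\dots,|z_{(k)}|)\qquad\text{for all } z\in\mathbb C^n.$$ For every such $a$ and every $\boldsymbol m\in\mathbb N_0^k$, the space $P^{m_1}(\mathbb C^{n_1})\otimes\cdots\otimes P^{m_k}(\mathbb C^{n_k})$ is contained in $\mathcal F(\mathbb C^n)$, and $$T_\varphi f=\gamma_{\boldsymbol n,a}(\boldsymbol m)\,f\qquad\text{for all } f\in P^{m_1}(\mathbb C^{n_1})\otimes\cdots\otimes P^{m_k}(\mathbb C^{n_k}),$$ where $$\gamma_{\boldsymbol n,a}(\boldsymbol m)=\frac1{\prod_{i=1}^k(m_i+n_i-1)!}\int_{(0,\infty)^k}a(\sqrt{r_1},\dots,\sqrt{r_k})\Big(\prod_{i=1}^k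 r_i^{m_i+n_i-1}\Big)e^{-(r_1+\cdots+r_k)}\,dr_1\cdots dr_k$$ and the integral converges absolutely. Hence, with $\boldsymbol 1=(1,\dots,1)\in\mathbb N^k$, $$\gamma_{\boldsymbol n,a}(\boldsymbol m)=\gamma_{\boldsymbol 1,a}(\boldsymbol m+\boldsymbol n-\boldsymbol 1).$$ -/

import Mathlib

open MeasureTheory
open scoped ENNReal ComplexConjugate

noncomputable section

namespace QuasiRadial

/-- `ℂ^n = ℂ^{n_1} × ⋯ × ℂ^{n_k}`; the `j`-th coordinate of the block `z_(i)` is `z i j`.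
The type carries the product topology and the product Lebesgue measure `volume`. -/
abbrev Cn {k : ℕ} (n : Fin k → ℕ) : Type := (i : Fin k) → Fin (n i) → ℂ

variable {k : ℕ} {n : Fin k → ℕ}

/-- The squared Euclidean norm `|z|²` on `ℂ^n`. -/
def normSq (z : Cn n) : ℝ := ∑ i, ∑ j, ‖z i j‖ ^ 2

/-- The Euclidean norms `(|z_(1)|, …, |z_(k)|)` of the blocks of `z`. -/
def blockNorms (z : Cn n) : Fin k → ℝ := fun i => Real.sqrt (∑ j, ‖z i j‖ ^ 2)

/-- The Gaussian measure `dλ_n(z) = π^{-(n_1+⋯+n_k)} e^{-|z|²} dz`. -/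
def gaussian (n : Fin k → ℕ) : Measure (Cn n) :=
  (volume : Measure (Cn n)).withDensity
    (fun z => ENNReal.ofReal ((Real.pi ^ (∑ i, n i))⁻¹ * Real.exp (-normSq z)))

/-- The Fock space: the entire functions on `ℂ^n` that are square integrable with respect to the
Gaussian measure. -/
def fock (n : Fin k → ℕ) : Submodule ℂ (Cn n → ℂ) where
  carrier := {f | Differentiable ℂ f ∧ MemLp f 2 (gaussian n)}
  add_mem' hf hg := ⟨hf.1.add hg.1, hf.2.add hg.2⟩
  zero_mem' := ⟨differentiable_const 0, MemLp.zero⟩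
  smul_mem' c _ hf := ⟨hf.1.const_smul c, hf.2.const_smul c⟩

/-- The reproducing kernel `K_z(w) = e^{⟨w, z⟩}`, where `⟨w, z⟩ = ∑ w_{ij} \bar z_{ij}`. -/
def kernel (z w : Cn n) : ℂ := Complex.exp (∑ i, ∑ j, w i j * conj (z i j))

/-- The Bergman projection `(P g)(z) = ⟨g, K_z⟩ = ∫ g(w) \overline{K_z(w)} dλ_n(w)`. -/
def bergman (g : Cn n → ℂ) (z : Cn n) : ℂ := ∫ w, g w * conj (kernel z w) ∂(gaussian n)

/-! ### The Bergman projection maps `L²` linearly into the Fock space -/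

/-- The `ℓ¹`-norm on `ℂ^n`, used for estimates. -/
def normOne (w : Cn n) : ℝ := ∑ i, ∑ j, ‖w i j‖

lemma continuous_normSq : Continuous (normSq (n := n)) := by unfold normSq; fun_prop

lemma continuous_normOne : Continuous (normOne (n := n)) := by unfold normOne; fun_prop

lemma normOne_nonneg (w : Cn n) : 0 ≤ normOne w := by unfold normOne; positivity

lemma continuous_kernel : Continuous (fun p : Cn n × Cn n => kernel p.1 p.2) := by
  unfold kernel; fun_prop

lemma integrable_exp_neg_sq {c : ℝ} (hc : 0 < c) :
    Integrable (fun x : ℂ => Real.exp (-(c * ‖x‖ ^ 2))) := by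
  have h := (GaussianFourier.integrable_cexp_neg_mul_sq_norm_add (V := ℂ) (b := (c : ℂ))
    (by simpa using hc) 0 0).norm
  refine h.congr (Filter.Eventually.of_forall fun x => ?_)
  simp [Complex.norm_exp, ← Complex.ofReal_pow]

lemma integrable_exp_normSq {c : ℝ} (hc : 0 < c) :
    Integrable (fun z : Cn n => Real.exp (-(c * normSq z))) := by
  have h : Integrable (fun z : Cn n => ∏ i, ∏ j, Real.exp (-(c * ‖z i j‖ ^ 2))) :=
    Integrable.fintype_prod_dep (f := fun i (y : Fin (n i) → ℂ) =>
      ∏ j, Real.exp (-(c * ‖y j‖ ^ 2))) (fun i =>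
        Integrable.fintype_prod (f := fun _ (x : ℂ) => Real.exp (-(c * ‖x‖ ^ 2)))
          (fun _ => integrable_exp_neg_sq hc))
  refine h.congr (Filter.Eventually.of_forall fun z => ?_)
  simp only [normSq, ← Real.exp_sum, Finset.mul_sum, Finset.sum_neg_distrib]

lemma exp_normOne_le (c : ℝ) : ∃ C : ℝ, 0 ≤ C ∧ ∀ w : Cn n,
    Real.exp (c * normOne w - normSq w) ≤ C * Real.exp (-((1 / 2) * normSq w)) := by
  refine ⟨Real.exp (∑ i, ∑ _j : Fin (n i), c ^ 2 / 2), (Real.exp_pos _).le, fun w => ?_⟩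
  rw [← Real.exp_add]
  apply Real.exp_le_exp.mpr
  have : (∑ i, ∑ j, (c * ‖w i j‖)) ≤
      ∑ i, ∑ j : Fin (n i), (c ^ 2 / 2 + (1 / 2) * ‖w i j‖ ^ 2) :=
    Finset.sum_le_sum fun i _ => Finset.sum_le_sum fun j _ => by
      nlinarith [sq_nonneg (c - ‖w i j‖)]
  simp only [Finset.sum_add_distrib, ← Finset.mul_sum] at this
  simp only [normOne, normSq]
  linarith

lemma integrable_gaussian_iff {E : Type*} [NormedAddCommGroup E] [NormedSpace ℝ E] {g : Cn n → E} :
    Integrable g (gaussian n) ↔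
      Integrable (fun z => ((Real.pi ^ (∑ i, n i))⁻¹ * Real.exp (-normSq z)) • g z) := by
  have hm : Measurable fun z : Cn n =>
      ENNReal.ofReal ((Real.pi ^ (∑ i, n i))⁻¹ * Real.exp (-normSq z)) :=
    (ENNReal.continuous_ofReal.comp (by have := continuous_normSq (n := n); fun_prop)).measurable
  rw [gaussian, integrable_withDensity_iff_integrable_smul' hm
    (Filter.Eventually.of_forall fun _ => ENNReal.ofReal_lt_top)]
  refine integrable_congr (Filter.Eventually.of_forall fun z => ?_)
  simp only
  rw [ENNReal.toReal_ofReal (by positivity)]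

lemma memLp_exp_normOne (c : ℝ) : MemLp (fun w : Cn n => Real.exp (c * normOne w)) 2 (gaussian n) := by
  have hcont : Continuous (fun w : Cn n => Real.exp (c * normOne w)) := by
    have := continuous_normOne (n := n); fun_prop
  rw [memLp_two_iff_integrable_sq_norm hcont.aestronglyMeasurable, integrable_gaussian_iff]
  obtain ⟨C, _, h⟩ := exp_normOne_le (n := n) (2 * c)
  have hq := continuous_normSq (n := n)
  refine Integrable.mono' (((integrable_exp_normSq (n := n) (c := 1 / 2) (by norm_num)).const_mul
    ((Real.pi ^ (∑ i, n i))⁻¹ * C))) (by fun_prop) (Filter.Eventually.of_forall fun w => ?_)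
  have e : Real.exp (-normSq w) * Real.exp (c * normOne w) ^ 2
      = Real.exp (2 * c * normOne w - normSq w) := by
    rw [← Real.exp_nat_mul, ← Real.exp_add]; congr 1; push_cast; ring
  rw [Real.norm_of_nonneg (by simp only [smul_eq_mul]; positivity), smul_eq_mul,
    Real.norm_of_nonneg (Real.exp_pos _).le, mul_assoc, e,
    mul_assoc (Real.pi ^ (∑ i, n i))⁻¹ C]
  exact mul_le_mul_of_nonneg_left (h w) (by positivity)

lemma norm_kernel_le {z : Cn n} {R : ℝ} (hz : ‖z‖ ≤ R) (w : Cn n) :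
    ‖kernel z w‖ ≤ Real.exp (R * normOne w) := by
  rw [kernel, Complex.norm_exp]
  apply Real.exp_le_exp.mpr
  refine (Complex.re_le_norm _).trans ((norm_sum_le _ _).trans ?_)
  rw [normOne, Finset.mul_sum]
  refine Finset.sum_le_sum fun i _ => (norm_sum_le _ _).trans ?_
  rw [Finset.mul_sum]
  refine Finset.sum_le_sum fun j _ => ?_
  rw [norm_mul, RCLike.norm_conj, mul_comm]
  exact mul_le_mul_of_nonneg_right
    (((norm_le_pi_norm (z i) j).trans (norm_le_pi_norm z i)).trans hz) (norm_nonneg _)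

lemma integrable_mul_exp {g : Cn n → ℂ} (hg : MemLp g 2 (gaussian n)) (c : ℝ) :
    Integrable (fun w => ‖g w‖ * Real.exp (c * normOne w)) (gaussian n) :=
  hg.norm.integrable_mul (memLp_exp_normOne c)

lemma integrable_mul_kernel {g : Cn n → ℂ} (hg : MemLp g 2 (gaussian n)) (z : Cn n) :
    Integrable (fun w => g w * conj (kernel z w)) (gaussian n) := by
  have hk : Continuous (fun w => kernel z w) :=
    continuous_kernel.comp (continuous_const.prodMk continuous_id)
  refine Integrable.mono' (integrable_mul_exp hg ‖z‖)
    (hg.aestronglyMeasurable.mul (Complex.continuous_conj.comp hk).aestronglyMeasurable)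
    (Filter.Eventually.of_forall fun w => ?_)
  rw [norm_mul, RCLike.norm_conj]
  exact mul_le_mul_of_nonneg_left (norm_kernel_le le_rfl w) (norm_nonneg _)

/-- The linear form `z ↦ ∑ \bar w_{ij} z_{ij}`. -/
def pairing (w : Cn n) : Cn n →L[ℂ] ℂ :=
  ∑ i, ∑ j, conj (w i j) •
    (ContinuousLinearMap.proj (R := ℂ) (φ := fun _ : Fin (n i) => ℂ) j ∘L
      ContinuousLinearMap.proj (R := ℂ) (φ := fun i : Fin k => (Fin (n i) → ℂ)) i)

lemma pairing_apply (w z : Cn n) : pairing w z = ∑ i, ∑ j, conj (w i j) * z i j := by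
  simp [pairing]

lemma continuous_pairing : Continuous (pairing (n := n)) := by
  unfold pairing
  fun_prop

lemma norm_pairing_le (w : Cn n) : ‖pairing w‖ ≤ normOne w := by
  refine ContinuousLinearMap.opNorm_le_bound _ (normOne_nonneg w) fun z => ?_
  rw [pairing_apply, normOne, Finset.sum_mul]
  refine (norm_sum_le _ _).trans (Finset.sum_le_sum fun i _ => (norm_sum_le _ _).trans ?_)
  rw [Finset.sum_mul]
  refine Finset.sum_le_sum fun j _ => ?_
  rw [norm_mul, RCLike.norm_conj]
  exact mul_le_mul_of_nonneg_left ((norm_le_pi_norm (z i) j).trans (norm_le_pi_norm z i))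
    (norm_nonneg _)

lemma conj_kernel (z w : Cn n) : conj (kernel z w) = Complex.exp (pairing w z) := by
  rw [kernel, ← Complex.exp_conj, pairing_apply]
  simp [map_sum]

lemma differentiable_bergman {g : Cn n → ℂ} (hg : MemLp g 2 (gaussian n)) :
    Differentiable ℂ (bergman g) := by
  intro z₀
  have hp := continuous_pairing (n := n)
  have key := hasFDerivAt_integral_of_dominated_of_fderiv_le (𝕜 := ℂ) (μ := gaussian n)
    (F := fun z w => g w * conj (kernel z w))
    (F' := fun z w => g w • (conj (kernel z w) • pairing w))
    (bound := fun w => ‖g w‖ * Real.exp ((‖z₀‖ + 2) * normOne w))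
    (x₀ := z₀) (s := Metric.ball z₀ 1) (Metric.ball_mem_nhds _ one_pos)
    (Filter.Eventually.of_forall fun z => (integrable_mul_kernel hg z).aestronglyMeasurable)
    (integrable_mul_kernel hg z₀) ?_ ?_ (integrable_mul_exp hg _) ?_
  · exact key.differentiableAt
  · have hk : Continuous (fun w => conj (kernel z₀ w) • pairing w) :=
      (Complex.continuous_conj.comp
        (continuous_kernel.comp (continuous_const.prodMk continuous_id))).smul hp
    exact hg.aestronglyMeasurable.smul hk.aestronglyMeasurable
  · refine Filter.Eventually.of_forall fun w z hz => ?_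
    have hz' : ‖z‖ ≤ ‖z₀‖ + 1 := by
      have h1 : ‖z - z₀‖ < 1 := by simpa [dist_eq_norm] using hz
      have := norm_le_insert' z z₀
      linarith
    rw [norm_smul, norm_smul, RCLike.norm_conj]
    refine mul_le_mul_of_nonneg_left ?_ (norm_nonneg _)
    have e : Real.exp ((‖z₀‖ + 2) * normOne w)
        = Real.exp ((‖z₀‖ + 1) * normOne w) * Real.exp (normOne w) := by
      rw [← Real.exp_add]; congr 1; ring
    rw [e]
    refine mul_le_mul (norm_kernel_le hz' w) ?_ (norm_nonneg _) (Real.exp_pos _).le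
    exact (norm_pairing_le w).trans (by linarith [Real.add_one_le_exp (normOne w)])
  · refine Filter.Eventually.of_forall fun w z _ => ?_
    simp only [conj_kernel]
    exact ((pairing w).hasFDerivAt.cexp).const_mul (g w)

lemma normSq_sub (z w : Cn n) :
    normSq (z - w) = normSq z + normSq w
      - 2 * (∑ i, ∑ j, w i j * conj (z i j)).re := by
  simp only [normSq, Complex.re_sum, Finset.mul_sum, ← Finset.sum_add_distrib,
    ← Finset.sum_sub_distrib, Pi.sub_apply]
  refine Finset.sum_congr rfl fun i _ => Finset.sum_congr rfl fun j _ => ?_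
  simp only [Complex.sq_norm, Complex.normSq_apply, Complex.mul_re, Complex.sub_re,
    Complex.sub_im, Complex.conj_re, Complex.conj_im]
  ring

lemma norm_kernel_eq (z w : Cn n) :
    Real.exp (-normSq w) * ‖kernel z w‖ =
      Real.exp (normSq z / 2) *
        (Real.exp (-(normSq w / 2)) * Real.exp (-(1 / 2 * normSq (z - w)))) := by
  rw [kernel, Complex.norm_exp, ← Real.exp_add, ← Real.exp_add, ← Real.exp_add, normSq_sub]
  congr 1
  ring

lemma lintegral_gaussian {u : Cn n → ℝ≥0∞} :
    ∫⁻ z, u z ∂(gaussian n) =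
      ∫⁻ z, ENNReal.ofReal ((Real.pi ^ (∑ i, n i))⁻¹ * Real.exp (-normSq z)) * u z := by
  have hm : Measurable fun z : Cn n =>
      ENNReal.ofReal ((Real.pi ^ (∑ i, n i))⁻¹ * Real.exp (-normSq z)) :=
    (ENNReal.continuous_ofReal.comp (by have := continuous_normSq (n := n); fun_prop)).measurable
  rw [gaussian, lintegral_withDensity_eq_lintegral_mul_non_measurable _ hm
    (Filter.Eventually.of_forall fun _ => ENNReal.ofReal_lt_top)]
  rfl

lemma gaussian_ac : gaussian n ≪ volume := withDensity_absolutelyContinuous _ _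

lemma ac_gaussian : volume ≪ gaussian n := by
  have hm : Measurable fun z : Cn n =>
      ENNReal.ofReal ((Real.pi ^ (∑ i, n i))⁻¹ * Real.exp (-normSq z)) :=
    (ENNReal.continuous_ofReal.comp (by have := continuous_normSq (n := n); fun_prop)).measurable
  refine withDensity_absolutelyContinuous' hm.aemeasurable
    (Filter.Eventually.of_forall fun z => ?_)
  rw [Ne, ENNReal.ofReal_eq_zero, not_le]
  positivity

/-- Cauchy-Schwarz for a convolution. -/
lemma conv_sq_le {H S : Cn n → ℝ≥0∞} (hH : AEMeasurable H) (hS : Measurable S)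
    (hev : ∀ w, S (-w) = S w) (z : Cn n) :
    (∫⁻ w, H w * S (z - w) ^ 2) ^ 2 ≤
      (∫⁻ w, H w ^ 2 * S (z - w) ^ 2) * ∫⁻ w, S w ^ 2 := by
  have hS' : Measurable fun w => S (z - w) := hS.comp (by fun_prop)
  have h := ENNReal.lintegral_mul_le_Lp_mul_Lq volume Real.HolderConjugate.two_two
    (hH.mul hS'.aemeasurable) hS'.aemeasurable
  have e1 : ∀ x : ℝ≥0∞, (x ^ ((1 : ℝ) / 2)) ^ 2 = x := fun x => by
    rw [← ENNReal.rpow_natCast, ← ENNReal.rpow_mul]; norm_num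
  have h2 := pow_le_pow_left₀ (zero_le) h 2
  rw [mul_pow, e1, e1] at h2
  simp only [Pi.mul_apply, ENNReal.rpow_ofNat, mul_pow] at h2
  have e2 : ∫⁻ w, S (z - w) ^ 2 = ∫⁻ w, S w ^ 2 := by
    rw [← lintegral_sub_right_eq_self (fun w => S w ^ 2) z]
    exact lintegral_congr fun w => by rw [← neg_sub, hev]
  rw [e2] at h2
  refine le_trans (le_of_eq ?_) h2
  congr 2
  funext w
  ring

lemma lintegral_conv_lt_top {H S : Cn n → ℝ≥0∞} (hH : AEMeasurable H) (hS : Measurable S)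
    (hev : ∀ w, S (-w) = S w) (hH2 : ∫⁻ w, H w ^ 2 < ∞) (hS2 : ∫⁻ w, S w ^ 2 < ∞) :
    ∫⁻ z, (∫⁻ w, H w * S (z - w) ^ 2) ^ 2 < ∞ := by
  have hS' : Measurable fun p : Cn n × Cn n => S (p.1 - p.2) := hS.comp (by fun_prop)
  calc ∫⁻ z, (∫⁻ w, H w * S (z - w) ^ 2) ^ 2
      ≤ ∫⁻ z, (∫⁻ w, H w ^ 2 * S (z - w) ^ 2) * ∫⁻ w, S w ^ 2 :=
        lintegral_mono fun z => conv_sq_le hH hS hev z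
    _ = (∫⁻ z, ∫⁻ w, H w ^ 2 * S (z - w) ^ 2) * ∫⁻ w, S w ^ 2 :=
        lintegral_mul_const' _ _ hS2.ne
    _ = (∫⁻ w, ∫⁻ z, H w ^ 2 * S (z - w) ^ 2) * ∫⁻ w, S w ^ 2 := by
        rw [lintegral_lintegral_swap]
        exact ((hH.pow_const 2).comp_snd).mul (hS'.pow_const 2).aemeasurable
    _ = (∫⁻ w, H w ^ 2 * ∫⁻ z, S z ^ 2) * ∫⁻ w, S w ^ 2 := by
        congr 2
        funext w
        have hw : Measurable fun z => S (z - w) := hS.comp (by fun_prop)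
        rw [lintegral_const_mul _ (hw.pow_const 2),
          lintegral_sub_right_eq_self (fun z => S z ^ 2) w]
    _ < ∞ := by
        rw [lintegral_mul_const' _ _ hS2.ne]
        exact ENNReal.mul_lt_top (ENNReal.mul_lt_top hH2 hS2) hS2

lemma lintegral_sq_lt_top {E : Type*} [NormedAddCommGroup E] {μ : Measure (Cn n)} {f : Cn n → E}
    (hf : MemLp f 2 μ) : ∫⁻ z, ‖f z‖ₑ ^ 2 ∂μ < ∞ := by
  have h := (memLp_two_iff_integrable_sq_norm hf.1).1 hf |>.2
  simpa [HasFiniteIntegral] using h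

lemma memLp_bergman {g : Cn n → ℂ} (hg : MemLp g 2 (gaussian n)) :
    MemLp (bergman g) 2 (gaussian n) := by
  have hmeas := (differentiable_bergman hg).continuous.aestronglyMeasurable (μ := gaussian n)
  have hq := continuous_normSq (n := n)
  rw [memLp_two_iff_integrable_sq_norm hmeas]
  refine ⟨hmeas.norm.pow 2, ?_⟩
  set c : ℝ := (Real.pi ^ (∑ i, n i))⁻¹ with hc
  have hc0 : 0 < c := by positivity
  set H : Cn n → ℝ≥0∞ := fun w => ‖g w‖ₑ * ENNReal.ofReal (Real.exp (-(normSq w / 2))) with hHdef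
  set S : Cn n → ℝ≥0∞ := fun w => ENNReal.ofReal (Real.exp (-(1 / 4 * normSq w))) with hSdef
  have hS : Measurable S := (ENNReal.continuous_ofReal.comp (by fun_prop)).measurable
  have hH : AEMeasurable H := (hg.1.mono_ac ac_gaussian).enorm.mul
    (ENNReal.continuous_ofReal.comp (by fun_prop)).measurable.aemeasurable
  have hSsq : ∀ w, S w ^ 2 = ENNReal.ofReal (Real.exp (-(1 / 2 * normSq w))) := fun w => by
    rw [hSdef, ← ENNReal.ofReal_pow (Real.exp_pos _).le, ← Real.exp_nat_mul]
    congr 2; push_cast; ring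
  have hS2 : ∫⁻ w, S w ^ 2 < ∞ := by
    have := (integrable_exp_normSq (n := n) (c := 1 / 2) (by norm_num)).lintegral_lt_top
    simpa only [hSsq] using this
  have hH2 : ∫⁻ w, H w ^ 2 < ∞ := by
    have h := lintegral_sq_lt_top hg
    rw [lintegral_gaussian] at h
    have e : ∀ w, ENNReal.ofReal (c * Real.exp (-normSq w)) * ‖g w‖ₑ ^ 2
        = ENNReal.ofReal c * H w ^ 2 := fun w => by
      rw [hHdef, mul_pow, ← ENNReal.ofReal_pow (Real.exp_pos _).le, ← Real.exp_nat_mul,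
        ENNReal.ofReal_mul hc0.le]
      have : ((2 : ℕ) : ℝ) * -(normSq w / 2) = -normSq w := by push_cast; ring
      rw [this]; ring
    simp only [← hc, e] at h
    rw [lintegral_const_mul' _ _ ENNReal.ofReal_ne_top] at h
    refine lt_top_iff_ne_top.2 fun ht => ?_
    rw [ht, ENNReal.mul_top (by simpa using hc0)] at h
    exact lt_irrefl _ h
  have hpt : ∀ z, ‖bergman g z‖ₑ ≤ ENNReal.ofReal (c * Real.exp (normSq z / 2)) *
      ∫⁻ w, H w * S (z - w) ^ 2 := fun z => by
    refine (enorm_integral_le_lintegral_enorm _).trans (le_of_eq ?_)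
    rw [lintegral_gaussian, ← lintegral_const_mul' _ _ ENNReal.ofReal_ne_top]
    refine lintegral_congr fun w => ?_
    rw [hSsq, hHdef, enorm_mul, ← ofReal_norm (conj (kernel z w)), RCLike.norm_conj]
    rw [mul_left_comm, ← ENNReal.ofReal_mul (by positivity), mul_assoc c, norm_kernel_eq z w,
      mul_assoc ‖g w‖ₑ, ← ENNReal.ofReal_mul (by positivity), mul_left_comm _ ‖g w‖ₑ,
      ← ENNReal.ofReal_mul (by positivity), mul_assoc c]
  have hfin := lintegral_conv_lt_top hH hS (fun w => by simp [hSdef, normSq]) hH2 hS2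
  have hle : ∫⁻ z, ‖‖bergman g z‖ ^ 2‖ₑ ∂(gaussian n) ≤
      ∫⁻ z, ENNReal.ofReal (c ^ 3) * (∫⁻ w, H w * S (z - w) ^ 2) ^ 2 := by
    rw [lintegral_gaussian]
    refine lintegral_mono fun z => ?_
    have h2 := pow_le_pow_left₀ (zero_le) (hpt z) 2
    rw [mul_pow, ← ENNReal.ofReal_pow (by positivity)] at h2
    have e : c * Real.exp (-normSq z) * (c * Real.exp (normSq z / 2)) ^ 2 = c ^ 3 := by
      have : Real.exp (normSq z / 2) ^ 2 = Real.exp (normSq z) := by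
        rw [← Real.exp_nat_mul]; congr 1; push_cast; ring
      rw [mul_pow, this, Real.exp_neg]
      field_simp
    simp only [enorm_pow, enorm_norm, ← hc]
    refine (mul_le_mul_right h2 _).trans (le_of_eq ?_)
    rw [← mul_assoc, ← ENNReal.ofReal_mul (by positivity), e]
  refine hle.trans_lt ?_
  rw [lintegral_const_mul' _ _ ENNReal.ofReal_ne_top]
  exact ENNReal.mul_lt_top ENNReal.ofReal_lt_top hfin

lemma bergman_mem_fock {g : Cn n → ℂ} (hg : MemLp g 2 (gaussian n)) : bergman g ∈ fock n :=
  ⟨differentiable_bergman hg, memLp_bergman hg⟩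

lemma memLp_symbol_mul {φ f : Cn n → ℂ} (hφ : MemLp φ ∞ volume) (hf : MemLp f 2 (gaussian n)) :
    MemLp (fun w => φ w * f w) 2 (gaussian n) := by
  have hφ' : MemLp φ ∞ (gaussian n) := ⟨hφ.1.mono_ac gaussian_ac, by
    have := hφ.2
    rw [eLpNorm_exponent_top] at this ⊢
    exact (eLpNormEssSup_mono_measure φ gaussian_ac).trans_lt this⟩
  exact hf.mul' hφ'

/-! ### Toeplitz operators with quasi-radial symbols -/

/-- The Toeplitz operator `T_φ f = P(φ f)` on the Fock space, for `φ ∈ L^∞(ℂ^n)`; that is,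
`(T_φ f)(z) = ∫ φ(w) f(w) \overline{K_z(w)} dλ_n(w)`. -/
def toeplitz (φ : Cn n → ℂ) (hφ : MemLp φ ∞ volume) : fock n →ₗ[ℂ] fock n where
  toFun f := ⟨bergman (fun w => φ w * (f : Cn n → ℂ) w),
    bergman_mem_fock (memLp_symbol_mul hφ f.2.2)⟩
  map_add' f g := by
    ext z
    simp only [Submodule.coe_add, Pi.add_apply, bergman, mul_add, add_mul]
    exact integral_add (integrable_mul_kernel (memLp_symbol_mul hφ f.2.2) z)
      (integrable_mul_kernel (memLp_symbol_mul hφ g.2.2) z)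
  map_smul' c f := by
    ext z
    simp only [Submodule.coe_smul, Pi.smul_apply, bergman, smul_eq_mul, RingHom.id_apply]
    rw [← integral_const_mul]
    exact integral_congr_ae (Filter.Eventually.of_forall fun w => by ring)

/-- `φ ∈ L^∞(ℂ^n)^G`: `φ` is measurable, essentially bounded (with respect to Lebesgue measure) and
invariant under `G = U_{n_1} × ⋯ × U_{n_k}` acting blockwise. -/
structure IsQuasiRadialSymbol (φ : Cn n → ℂ) : Prop where
  memLp : MemLp φ ∞ volume
  invariant : ∀ (A : (i : Fin k) → Matrix.unitaryGroup (Fin (n i)) ℂ) (z : Cn n),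
    φ (fun i => ((A i)⁻¹ : Matrix.unitaryGroup (Fin (n i)) ℂ).1.mulVec (z i)) = φ z

/-- `P^{m_1}(ℂ^{n_1}) ⊗ ⋯ ⊗ P^{m_k}(ℂ^{n_k})`, as the space of functions on `ℂ^n` spanned by the
products `z ↦ ∏ p_i(z_(i))` of homogeneous polynomials `p_i` of degree `m_i` on `ℂ^{n_i}`. -/
def homPoly (n m : Fin k → ℕ) : Submodule ℂ (Cn n → ℂ) :=
  Submodule.span ℂ {f | ∃ p : (i : Fin k) → MvPolynomial (Fin (n i)) ℂ,
    (∀ i, (p i).IsHomogeneous (m i)) ∧ f = fun z => ∏ i, MvPolynomial.eval (z i) (p i)}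

/-- The open orthant `ℝ_+^k`. -/
def orthant (k : ℕ) : Set (Fin k → ℝ) := Set.univ.pi fun _ => Set.Ioi 0

/-- The integrand `a(√r) r^{m+n-1} e^{-(r_1+⋯+r_k)}`; the components of `n` are positive. -/
def gammaIntegrand (n : Fin k → ℕ) (a : (Fin k → ℝ) → ℂ) (m : Fin k → ℕ) (r : Fin k → ℝ) : ℂ :=
  a (fun i => Real.sqrt (r i)) *
    (((∏ i, r i ^ (m i + n i - 1)) * Real.exp (-∑ i, r i) : ℝ) : ℂ)

/-- `γ_{n,a}(m) = (1 / (m+n-1)!) ∫_{ℝ_+^k} a(√r) r^{m+n-1} e^{-(r_1+⋯+r_k)} dr`, with multi-index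
factorials. -/
def gamma (n : Fin k → ℕ) (a : (Fin k → ℝ) → ℂ) (m : Fin k → ℕ) : ℂ :=
  (1 / ((∏ i, (m i + n i - 1).factorial : ℕ) : ℂ)) *
    ∫ r in orthant k, gammaIntegrand n a m r

end QuasiRadial
end

/-! The group acts transitively on products of spheres, so an invariant symbol depends only on the
block norms (`exists_unitary_mulVec_eq`). For the eigenvalue formula it suffices, by linearity, to
take a product of homogeneous polynomials; its integral against the conjugate kernel is then
assembled from single blocks.

In one block, let `p` be homogeneous of degree `m`, and let a bounded radial weight multiply `p`
times the exponential of a conjugate-linear form. Circle invariance kills every term of the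
exponential series except the `m`-th (`integral_mul_cexp_of_circle`). What remains is homogeneous of
degree `2 * m` under positive scaling, so polar coordinates give a constant times a radial integral,
with a constant independent of the weight (`exists_integral_sumSq_mul_homogeneous`). Weight one is
the reproducing property of the kernel on polynomials (`integral_eval_mul_cexp`), and this
determines the constant without computing any integral over a sphere
(`integral_radial_mul_eval_mul_cexp`).

The profile couples the blocks, so the one-block identities are combined by Fubini for a weight that
is not a product (`integral_comp_mul_prod`). This needs a bounded Borel weight, whereas `a` is an
arbitrary function; `exists_measurable_profile` shows that it agrees almost everywhere with such a
weight, using only that scalings preserve null sets. -/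

namespace QuasiRadial

/-! ### Unitary orbits and the radial profile -/

/-- The unitary group acts transitively on the spheres of `ℂ^d`. -/
lemma exists_unitary_mulVec_eq {d : ℕ} {x y : Fin d → ℂ}
    (h : ∑ j, ‖x j‖ ^ 2 = ∑ j, ‖y j‖ ^ 2) :
    ∃ A : Matrix.unitaryGroup (Fin d) ℂ, A.1.mulVec x = y := by
  have hn : ‖WithLp.toLp 2 x‖ = ‖WithLp.toLp 2 y‖ := by
    simp only [EuclideanSpace.norm_eq, h]
  by_cases hx : WithLp.toLp 2 x = 0
  · rw [hx, norm_zero, eq_comm, norm_eq_zero] at hn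
    have hx' : x = 0 := by simpa using hx
    have hy' : y = 0 := by simpa using hn
    exact ⟨1, by simp [hx', hy']⟩
  have hx0 : ‖WithLp.toLp 2 x‖ ≠ 0 := norm_ne_zero_iff.2 hx
  set c : ℂ := ((‖WithLp.toLp 2 x‖ : ℝ) : ℂ) with hc
  have hc0 : c ≠ 0 := by simpa [hc] using hx
  have hu : ‖c⁻¹ • WithLp.toLp 2 x‖ = 1 := by
    rw [norm_smul, norm_inv, hc, Complex.norm_real, norm_norm, inv_mul_cancel₀ hx0]
  have hv : ‖c⁻¹ • WithLp.toLp 2 y‖ = 1 := by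
    rw [norm_smul, norm_inv, hc, Complex.norm_real, norm_norm, hn, inv_mul_cancel₀ (hn ▸ hx0)]
  -- The isometry from the line through `x` to the line through `y` that matches the two unit
  -- vectors. It extends to the whole space, and an isometry of a finite-dimensional space into
  -- itself is onto.
  let L := (LinearIsometry.toSpanSingleton ℂ (EuclideanSpace ℂ (Fin d)) hv).comp
    (LinearIsometryEquiv.toSpanUnitSingleton _ hu).symm.toLinearIsometry
  let U := L.extend.toLinearIsometryEquiv rfl
  have hU : U (WithLp.toLp 2 x) = WithLp.toLp 2 y := by
    have h1 : U (c⁻¹ • WithLp.toLp 2 x) = c⁻¹ • WithLp.toLp 2 y := by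
      have h2 := L.extend_apply ⟨c⁻¹ • WithLp.toLp 2 x, Submodule.mem_span_singleton_self _⟩
      have h3 : (LinearIsometryEquiv.toSpanUnitSingleton _ hu).symm
          ⟨c⁻¹ • WithLp.toLp 2 x, Submodule.mem_span_singleton_self _⟩ = (1 : ℂ) := by
        rw [LinearIsometryEquiv.symm_apply_eq]
        ext1
        simp
      calc _ = L ⟨c⁻¹ • WithLp.toLp 2 x, Submodule.mem_span_singleton_self _⟩ := h2
        _ = _ := by simp [L, h3]
    rw [map_smul] at h1
    exact smul_right_injective _ (inv_ne_zero hc0) h1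
  let b := EuclideanSpace.basisFun (Fin d) ℂ
  refine ⟨⟨U.toMatrix b.toBasis b.toBasis, U.toMatrix_mem_unitaryGroup b b⟩, ?_⟩
  have h4 := LinearMap.toMatrix_mulVec_repr b.toBasis b.toBasis U.toLinearMap (WithLp.toLp 2 x)
  funext j
  have h5 := congrFun h4 j
  have h6 : (⇑(b.toBasis.repr (WithLp.toLp 2 x))) = x := by ext j; simp [b]
  rw [h6] at h5
  refine h5.trans ?_
  have : U.toLinearMap (WithLp.toLp 2 x) = WithLp.toLp 2 y := hU
  rw [this]
  simp [b]

lemma exists_eq_comp_blockNorms {k : ℕ} {n : Fin k → ℕ} {φ : Cn n → ℂ}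
    (hφ : IsQuasiRadialSymbol φ) : ∃ a : (Fin k → ℝ) → ℂ, ∀ z, φ z = a (blockNorms z) := by
  have hf : Function.FactorsThrough φ blockNorms := fun z w h => by
    have h' : ∀ i, ∃ A : Matrix.unitaryGroup (Fin (n i)) ℂ, A.1.mulVec (z i) = w i := fun i => by
      refine exists_unitary_mulVec_eq ?_
      have := congrFun h i
      simp only [blockNorms] at this
      rwa [Real.sqrt_inj (by positivity) (by positivity)] at this
    choose A hA using h'
    -- Invariance is phrased with inverses, so the inverses of the `A i` are inserted.
    have := hφ.invariant (fun i => (A i)⁻¹) z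
    simp only [inv_inv, hA] at this
    exact this.symm
  -- The default 0 off the range of `blockNorms` plays no role.
  exact ⟨Function.extend blockNorms φ 0, fun z => (hf.extend_apply _ z).symm⟩

/-! ### Averaging over the circle -/

/-- If `G` is homogeneous of degree `m` and `l` conjugate-homogeneous of degree one under the circle
action, only the `m`-th term of the exponential series contributes to `∫ G e^l`. -/
lemma integral_mul_cexp_of_circle {E : Type*} [MeasurableSpace E] [SMul ℂ E] {μ : Measure E}
    (hμ : ∀ u : ℂ, ‖u‖ = 1 → ∀ f : E → ℂ, ∫ x, f (u • x) ∂μ = ∫ x, f x ∂μ) (m : ℕ)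
    {G l : E → ℂ} (hG : ∀ u : ℂ, ‖u‖ = 1 → ∀ x, G (u • x) = u ^ m * G x)
    (hl : ∀ u : ℂ, ‖u‖ = 1 → ∀ x, l (u • x) = conj u * l x)
    (hGm : AEStronglyMeasurable G μ) (hlm : AEStronglyMeasurable l μ)
    (hint : Integrable (fun x => ‖G x‖ * Real.exp ‖l x‖) μ) :
    ∫ x, G x * Complex.exp (l x) ∂μ = ∫ x, G x * (l x ^ m / m.factorial) ∂μ := by
  have hs : HasSum (fun j : ℕ => ∫ x, G x * (l x ^ j / j.factorial) ∂μ)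
      (∫ x, G x * Complex.exp (l x) ∂μ) := by
    have hb : ∀ x, HasSum (fun j : ℕ => ‖G x‖ * (‖l x‖ ^ j / j.factorial))
        (‖G x‖ * Real.exp ‖l x‖) := fun x => by
      rw [Real.exp_eq_exp_ℝ]
      exact (NormedSpace.expSeries_div_hasSum_exp ‖l x‖).mul_left _
    refine hasSum_integral_of_dominated_convergence
      (fun (j : ℕ) x => ‖G x‖ * (‖l x‖ ^ j / j.factorial))
      (fun j => hGm.mul ((hlm.pow j).mul_const _)) (fun j => .of_forall fun x => ?_)
      (.of_forall fun x => (hb x).summable) ?_ (.of_forall fun x => ?_)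
    · simp
    · exact hint.congr (.of_forall fun x => (hb x).tsum_eq.symm)
    · rw [Complex.exp_eq_exp_ℂ]
      exact (NormedSpace.expSeries_div_hasSum_exp (l x)).mul_left _
  refine hs.unique (hasSum_single m fun j hj => ?_)
  have hrot : ∀ u : ℂ, ‖u‖ = 1 → ∫ x, G x * (l x ^ j / j.factorial) ∂μ =
      u ^ m * conj u ^ j * ∫ x, G x * (l x ^ j / j.factorial) ∂μ := fun u hu => by
    rw [← integral_const_mul, ← hμ u hu]
    refine integral_congr_ae (.of_forall fun x => ?_)
    simp only [hG u hu, hl u hu]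
    ring
  -- For `j ≠ m` the angle `π / (m - j)` gives `u ^ m * conj u ^ j = -1`, so the `j`-th integral
  -- equals its own negative.
  obtain ⟨u, hu, hu'⟩ : ∃ u : ℂ, ‖u‖ = 1 ∧ u ^ m * conj u ^ j ≠ 1 := by
    have hd : (m : ℝ) - j ≠ 0 := sub_ne_zero.2 (by exact_mod_cast hj.symm)
    refine ⟨Complex.exp ((Real.pi / (m - j) : ℝ) * Complex.I), Complex.norm_exp_ofReal_mul_I _, ?_⟩
    rw [← Complex.exp_conj, ← Complex.exp_nat_mul, ← Complex.exp_nat_mul, ← Complex.exp_add]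
    have : (m : ℂ) * ((Real.pi / (m - j) : ℝ) * Complex.I) +
        j * conj ((Real.pi / (m - j) : ℝ) * Complex.I) = Real.pi * Complex.I := by
      have hd' : (m : ℂ) - j ≠ 0 := by exact_mod_cast hd
      rw [map_mul, Complex.conj_ofReal, Complex.conj_I]
      push_cast
      field_simp
      ring
    rw [this, Complex.exp_pi_mul_I]
    norm_num
  have := hrot u hu
  by_contra h0
  exact hu' (mul_right_cancel₀ h0 (by rw [one_mul]; exact this.symm))

lemma measurePreserving_smul_of_norm_eq_one {d : ℕ} {u : ℂ} (hu : ‖u‖ = 1) :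
    MeasurePreserving (fun x : Fin d → ℂ => u • x) := by
  have h1 : MeasurePreserving (fun x : ℂ => u * x) := by
    have := (rotation ⟨u, by simpa [Submonoid.unitSphere] using hu⟩).measurePreserving
    exact this
  exact volume_preserving_pi (fun _ : Fin d => h1)

lemma integral_comp_smul_of_norm_eq_one {d : ℕ} {u : ℂ} (hu : ‖u‖ = 1) (f : (Fin d → ℂ) → ℂ) :
    ∫ x, f (u • x) = ∫ x, f x :=
  (measurePreserving_smul_of_norm_eq_one hu).integral_comp
    (measurableEmbedding_const_smul₀ (by rintro rfl; simp at hu)) f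

/-! ### Growth of polynomials -/

/-- An exponential bound is coarse, but it survives sums and multiplication by a variable, since `‖x
i‖` is below the exponential of the sum of all the norms. It is also the form in which Gaussian
integrability is available. -/
lemma norm_eval_le_exp {d : ℕ} (p : MvPolynomial (Fin d) ℂ) :
    ∃ C c : ℝ, 0 ≤ C ∧ 0 ≤ c ∧ ∀ x : Fin d → ℂ,
      ‖MvPolynomial.eval x p‖ ≤ C * Real.exp (c * ∑ j, ‖x j‖) := by
  have hs : ∀ x : Fin d → ℂ, 0 ≤ ∑ j, ‖x j‖ := fun x => by positivity
  induction p using MvPolynomial.induction_on with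
  | C a => exact ⟨‖a‖, 0, norm_nonneg _, le_rfl, fun x => by simp⟩
  | add p q hp hq =>
    obtain ⟨C, c, hC, hc, h⟩ := hp
    obtain ⟨C', c', hC', hc', h'⟩ := hq
    refine ⟨C + C', c + c', by positivity, by positivity, fun x => ?_⟩
    rw [map_add, add_mul]
    refine (norm_add_le _ _).trans (add_le_add ((h x).trans ?_) ((h' x).trans ?_)) <;>
    · gcongr
      linarith
  | mul_X p i hp =>
    obtain ⟨C, c, hC, hc, h⟩ := hp
    refine ⟨C, c + 1, hC, by positivity, fun x => ?_⟩
    rw [map_mul, MvPolynomial.eval_X, norm_mul, add_mul, Real.exp_add, ← mul_assoc, one_mul]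
    refine mul_le_mul (h x) ?_ (norm_nonneg _) (by positivity)
    have h1 := Finset.single_le_sum (f := fun j => ‖x j‖) (fun j _ => norm_nonneg _)
      (Finset.mem_univ i)
    linarith [Real.add_one_le_exp (∑ j, ‖x j‖)]

lemma differentiable_eval {d : ℕ} (p : MvPolynomial (Fin d) ℂ) :
    Differentiable ℂ (fun x : Fin d → ℂ => MvPolynomial.eval x p) := by
  induction p using MvPolynomial.induction_on with
  | C a => simp
  | add p q hp hq =>
    simp only [map_add]
    exact hp.add hq
  | mul_X p i hp =>
    simp only [map_mul, MvPolynomial.eval_X]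
    exact hp.mul (differentiable_apply i)

lemma homPoly_le_fock {k : ℕ} (n m : Fin k → ℕ) : homPoly n m ≤ fock n := by
  refine Submodule.span_le.2 ?_
  rintro _ ⟨p, -, rfl⟩
  have hd : Differentiable ℂ fun z : Cn n => ∏ i, MvPolynomial.eval (z i) (p i) := by
    have := fun i => (differentiable_eval (p i)).comp (differentiable_apply (𝕜 := ℂ)
      (F' := fun i => Fin (n i) → ℂ) i)
    simp only [Function.comp_def] at this
    fun_prop
  refine ⟨hd, ?_⟩
  choose C c hC hc h using fun i => norm_eval_le_exp (p i)
  refine ((memLp_exp_normOne (n := n) (∑ i, c i)).const_mul (∏ i, C i)).mono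
    hd.continuous.aestronglyMeasurable (.of_forall fun z => ?_)
  rw [Real.norm_of_nonneg (mul_nonneg (Finset.prod_nonneg fun i _ => hC i) (Real.exp_pos _).le),
    norm_prod]
  calc ∏ i, ‖MvPolynomial.eval (z i) (p i)‖
      ≤ ∏ i, (C i * Real.exp (c i * ∑ j, ‖z i j‖)) :=
        Finset.prod_le_prod (fun _ _ => norm_nonneg _) fun i _ => h i (z i)
    _ = (∏ i, C i) * Real.exp (∑ i, c i * ∑ j, ‖z i j‖) := by
        rw [Finset.prod_mul_distrib, Real.exp_sum]
    _ ≤ _ := by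
        refine mul_le_mul_of_nonneg_left (Real.exp_le_exp.2 ?_)
          (Finset.prod_nonneg fun i _ => hC i)
        rw [normOne, Finset.mul_sum]
        refine Finset.sum_le_sum fun i _ => mul_le_mul_of_nonneg_right ?_ (by positivity)
        exact Finset.single_le_sum (fun i _ => hc i) (Finset.mem_univ i)

/-! ### Integration in polar coordinates -/

/-- Homogeneity separates `F` into its restriction to the unit sphere and a power of the radius. No
integrability is required: the product formula for integrals holds unconditionally. -/
lemma integral_norm_mul_homogeneous {E : Type*} [NormedAddCommGroup E] [NormedSpace ℝ E]
    [FiniteDimensional ℝ E] [MeasurableSpace E] [BorelSpace E] [Nontrivial E] (μ : Measure E)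
    [μ.IsAddHaarMeasure] {M : ℕ} {F : E → ℂ}
    (hF : ∀ s : ℝ, 0 < s → ∀ x, F (s • x) = (s : ℂ) ^ M * F x) (h : ℝ → ℂ) :
    ∫ x, h ‖x‖ * F x ∂μ = (∫ ω, F ω.1 ∂μ.toSphere) *
      ∫ s in Set.Ioi (0 : ℝ), s ^ (Module.finrank ℝ E - 1) • ((s : ℂ) ^ M * h s) :=
  calc
    ∫ x, h ‖x‖ * F x ∂μ
      = ∫ x : ({(0)}ᶜ : Set E), h ‖x.1‖ * F x.1 ∂(μ.comap (↑)) := by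
      rw [integral_subtype_comap (measurableSet_singleton _).compl fun x ↦ h ‖x‖ * F x,
        restrict_compl_singleton]
    _ = ∫ x, F x.1.1 * ((x.2.1 : ℂ) ^ M * h x.2.1)
          ∂μ.toSphere.prod (.volumeIoiPow (Module.finrank ℝ E - 1)) := by
      rw [← μ.measurePreserving_homeomorphUnitSphereProd.integral_comp
        (Homeomorph.measurableEmbedding _)]
      refine integral_congr_ae (.of_forall fun x => ?_)
      have hx : 0 < ‖x.1‖ := norm_pos_iff.2 x.2
      have := hF ‖x.1‖ hx (‖x.1‖⁻¹ • x.1)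
      rw [smul_smul, mul_inv_cancel₀ hx.ne', one_smul] at this
      simp only [homeomorphUnitSphereProd_apply_snd_coe, homeomorphUnitSphereProd_apply_fst_coe]
      rw [this]
      ring
    _ = (∫ ω, F ω.1 ∂μ.toSphere) * ∫ s : Set.Ioi (0 : ℝ), (s.1 : ℂ) ^ M * h s.1
          ∂.volumeIoiPow (Module.finrank ℝ E - 1) :=
      integral_prod_mul (fun ω : Metric.sphere (0 : E) 1 => F ω.1)
        (fun s : Set.Ioi (0 : ℝ) => (s.1 : ℂ) ^ M * h s.1)
    _ = _ := by
      congr 1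
      simp only [Measure.volumeIoiPow, ENNReal.ofReal]
      rw [integral_withDensity_eq_integral_smul,
        integral_subtype_comap measurableSet_Ioi fun a : ℝ ↦
          Real.toNNReal (a ^ (Module.finrank ℝ E - 1)) • ((a : ℂ) ^ M * h a),
        setIntegral_congr_fun measurableSet_Ioi fun x hx ↦ ?_]
      · rw [NNReal.smul_def, Real.coe_toNNReal _ (pow_nonneg hx.out.le _)]
      · exact (measurable_subtype_coe.pow_const _).real_toNNReal

/-- The point is that `C` is chosen before `g`. The native norm on `Fin d → ℂ` is the sup norm, so
polar coordinates are taken in `EuclideanSpace`; the substitution `r = s ^ 2` produces the factor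
1/2. -/
lemma exists_integral_sumSq_mul_homogeneous {d : ℕ} (hd : 0 < d) {M : ℕ} {F : (Fin d → ℂ) → ℂ}
    (hF : ∀ s : ℝ, 0 < s → ∀ x, F ((s : ℂ) • x) = (s : ℂ) ^ (2 * M) * F x) :
    ∃ C : ℂ, ∀ g : ℝ → ℂ, ∫ x, g (∑ j, ‖x j‖ ^ 2) * F x =
      C * ∫ r in Set.Ioi (0 : ℝ), g r * ((r ^ (M + d - 1) : ℝ) : ℂ) := by
  have : Nonempty (Fin d) := ⟨⟨0, hd⟩⟩
  let L : (Fin d → ℂ) ≃L[ℝ] EuclideanSpace ℂ (Fin d) :=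
    (PiLp.continuousLinearEquiv 2 ℝ (fun _ : Fin d => ℂ)).symm
  have hL : MeasurableEmbedding L := L.toHomeomorph.measurableEmbedding
  refine ⟨(∫ ω, F (L.symm ω.1) ∂(volume.map L).toSphere) / 2, fun g => ?_⟩
  have hfr : Module.finrank ℝ (EuclideanSpace ℂ (Fin d)) = 2 * d := by
    rw [← L.toLinearEquiv.finrank_eq]
    simp [Module.finrank_pi_fintype, mul_comm]
  have h := integral_norm_mul_homogeneous (volume.map L) (M := 2 * M)
    (F := fun x => F (L.symm x)) (fun s hs x => hF s hs (L.symm x)) (fun s => g (s ^ 2))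
  rw [hL.integral_map] at h
  have e : ∀ x, ‖L x‖ ^ 2 = ∑ j, ‖x j‖ ^ 2 := fun x => by
    rw [EuclideanSpace.norm_sq_eq]
    rfl
  simp only [e, L.symm_apply_apply] at h
  rw [h, div_mul_eq_mul_div, mul_div_assoc]
  congr 1
  rw [← integral_comp_rpow_Ioi_of_pos (g := fun r => g r * ((r ^ (M + d - 1) : ℝ) : ℂ))
    (p := 2) two_pos, ← integral_div]
  refine setIntegral_congr_fun measurableSet_Ioi fun s hs => ?_
  have hs' : (0 : ℝ) < s := hs
  have e1 : 2 * d - 1 + 2 * M = 2 * (M + d - 1) + 1 := by omega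
  have e2 : (s : ℂ) ^ (2 * d - 1) * (s : ℂ) ^ (2 * M) = ((s : ℂ) ^ 2) ^ (M + d - 1) * s := by
    rw [← pow_add, e1, pow_succ, pow_mul]
  simp only [hfr, Complex.real_smul, Real.rpow_two]
  norm_num
  linear_combination g (s ^ 2) * e2

/-! ### The reproducing property on polynomials -/

lemma integrable_exp_sub_sq (c : ℝ) :
    Integrable (fun x : ℂ => Real.exp (c * ‖x‖ - ‖x‖ ^ 2)) := by
  refine Integrable.mono' ((integrable_exp_neg_sq (c := 1 / 2) (by norm_num)).const_mul
    (Real.exp (c ^ 2 / 2))) (by fun_prop) (.of_forall fun x => ?_)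
  rw [Real.norm_of_nonneg (Real.exp_pos _).le, ← Real.exp_add]
  refine Real.exp_le_exp.2 ?_
  nlinarith [sq_nonneg (c - ‖x‖)]

lemma integrable_exp_sum_sub_sq {d : ℕ} (c : ℝ) :
    Integrable (fun x : Fin d → ℂ => Real.exp (c * (∑ j, ‖x j‖) - ∑ j, ‖x j‖ ^ 2)) := by
  have h := Integrable.fintype_prod (ι := Fin d) (f := fun _ (x : ℂ) =>
    Real.exp (c * ‖x‖ - ‖x‖ ^ 2)) (fun _ => integrable_exp_sub_sq c)
  refine h.congr (.of_forall fun x => ?_)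
  simp only [← Real.exp_sum, Finset.sum_sub_distrib, Finset.mul_sum]

lemma integrable_pow_mul_exp (α : ℕ) (c : ℝ) :
    Integrable (fun x : ℂ => ‖x‖ ^ α * Real.exp (c * ‖x‖) * Real.exp (-‖x‖ ^ 2)) := by
  refine (integrable_exp_sub_sq (α + c)).mono' (by fun_prop) (.of_forall fun x => ?_)
  rw [Real.norm_of_nonneg (by positivity)]
  have h : ‖x‖ ^ α ≤ Real.exp (α * ‖x‖) := by
    rw [Real.exp_nat_mul]
    exact pow_le_pow_left₀ (norm_nonneg _) (by linarith [Real.add_one_le_exp ‖x‖]) _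
  calc _ ≤ Real.exp (α * ‖x‖) * Real.exp (c * ‖x‖) * Real.exp (-‖x‖ ^ 2) := by gcongr
    _ = _ := by
      rw [← Real.exp_add, ← Real.exp_add]
      ring_nf

/-- The circle average leaves `z ^ α / α!` times the integral of `‖x‖ ^ (2 * α) * exp (-‖x‖ ^ 2)`
over the plane, which is `π * α!` by the Gamma function. -/
lemma integral_pow_mul_cexp (α : ℕ) (z : ℂ) :
    ∫ x : ℂ, x ^ α * Complex.exp (conj x * z) * (Real.exp (-‖x‖ ^ 2) : ℂ) = Real.pi * z ^ α := by
  have h := integral_mul_cexp_of_circle (E := ℂ) (μ := volume) (fun u hu f => by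
      have := (rotation ⟨u, by simpa [Submonoid.unitSphere] using hu⟩).measurePreserving
      exact this.integral_comp (measurableEmbedding_const_smul₀
        (c := u) (by rintro rfl; simp at hu)) f) α
    (G := fun x => x ^ α * (Real.exp (-‖x‖ ^ 2) : ℂ)) (l := fun x => conj x * z)
    (fun u hu x => by simp only [smul_eq_mul, norm_mul, hu, one_mul]; ring)
    (fun u hu x => by simp only [smul_eq_mul, map_mul]; ring)
    (by fun_prop)
    (by fun_prop)
    ((integrable_pow_mul_exp α ‖z‖).congr (.of_forall fun x => by
      simp only [norm_mul, norm_pow, RCLike.norm_conj, Complex.norm_real,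
        Real.norm_of_nonneg (Real.exp_pos _).le]
      ring_nf))
  have e : ∫ x : ℂ, x ^ α * Complex.exp (conj x * z) * (Real.exp (-‖x‖ ^ 2) : ℂ) =
      ∫ x : ℂ, x ^ α * (Real.exp (-‖x‖ ^ 2) : ℂ) * Complex.exp (conj x * z) :=
    integral_congr_ae (.of_forall fun x => by ring)
  rw [e, h]
  have e2 : ∀ x : ℂ, x ^ α * (Real.exp (-‖x‖ ^ 2) : ℂ) * ((conj x * z) ^ α / α.factorial) =
      z ^ α / α.factorial * ((‖x‖ ^ ((2 * α : ℕ) : ℝ) * Real.exp (-‖x‖ ^ (2 : ℝ)) : ℝ) : ℂ) := by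
    intro x
    have : x ^ α * (conj x) ^ α = (‖x‖ : ℂ) ^ (2 * α) := by
      rw [← mul_pow, Complex.mul_conj, Complex.normSq_eq_norm_sq, pow_mul]
      norm_cast
    rw [Real.rpow_natCast, Real.rpow_two, mul_pow]
    push_cast
    rw [← this]
    ring
  simp only [e2]
  rw [integral_const_mul, integral_complex_ofReal,
    Complex.integral_rpow_mul_exp_neg_rpow one_le_two (by push_cast; linarith [α.cast_nonneg (α := ℝ)])]
  have : (((2 * α : ℕ) : ℝ) + 2) / 2 = α + 1 := by push_cast; ring
  rw [this, Real.Gamma_nat_eq_factorial]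
  have : (α.factorial : ℂ) ≠ 0 := by exact_mod_cast α.factorial_ne_zero
  push_cast
  field_simp

/-- On each monomial the integrand factors over the coordinates. Homogeneity is not needed here. -/
lemma integral_eval_mul_cexp {d : ℕ} (p : MvPolynomial (Fin d) ℂ) (z : Fin d → ℂ) :
    ∫ x : Fin d → ℂ, MvPolynomial.eval x p * Complex.exp (∑ j, conj (x j) * z j) *
      (Real.exp (-∑ j, ‖x j‖ ^ 2) : ℂ) = Real.pi ^ d * MvPolynomial.eval z p := by
  have e : ∀ x : Fin d → ℂ, MvPolynomial.eval x p * Complex.exp (∑ j, conj (x j) * z j) *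
      (Real.exp (-∑ j, ‖x j‖ ^ 2) : ℂ) = ∑ α ∈ p.support, p.coeff α *
        ∏ j, (x j ^ α j * Complex.exp (conj (x j) * z j) * (Real.exp (-‖x j‖ ^ 2) : ℂ)) := by
    intro x
    rw [MvPolynomial.eval_eq', Finset.sum_mul, Finset.sum_mul]
    refine Finset.sum_congr rfl fun α _ => ?_
    rw [Finset.prod_mul_distrib, Finset.prod_mul_distrib, ← Complex.exp_sum,
      ← Complex.ofReal_prod, ← Real.exp_sum, Finset.sum_neg_distrib]
    ring
  simp only [e]
  rw [integral_finsetSum]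
  · rw [MvPolynomial.eval_eq', Finset.mul_sum]
    refine Finset.sum_congr rfl fun α _ => ?_
    rw [integral_const_mul, integral_fintype_prod_volume_eq_prod (fun j (x : ℂ) =>
      x ^ α j * Complex.exp (conj x * z j) * (Real.exp (-‖x‖ ^ 2) : ℂ))]
    simp only [integral_pow_mul_cexp, Finset.prod_mul_distrib, Finset.prod_const, Finset.card_univ,
      Fintype.card_fin]
    ring
  · refine fun α _ => Integrable.const_mul ?_ _
    refine Integrable.fintype_prod (f := fun j (x : ℂ) =>
      x ^ α j * Complex.exp (conj x * z j) * (Real.exp (-‖x‖ ^ 2) : ℂ)) fun j => ?_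
    refine (integrable_pow_mul_exp (α j) ‖z j‖).mono' (by fun_prop) (.of_forall fun x => ?_)
    simp only [norm_mul, norm_pow, Complex.norm_real, Real.norm_of_nonneg (Real.exp_pos _).le]
    gcongr
    rw [Complex.norm_exp]
    refine Real.exp_le_exp.2 ((Complex.re_le_norm _).trans ?_)
    rw [norm_mul, RCLike.norm_conj, mul_comm]

/-! ### Radial weights in one block -/

lemma eval_smul_of_isHomogeneous {d m : ℕ} {p : MvPolynomial (Fin d) ℂ} (hp : p.IsHomogeneous m)
    (c : ℂ) (x : Fin d → ℂ) :
    MvPolynomial.eval (c • x) p = c ^ m * MvPolynomial.eval x p := by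
  rw [MvPolynomial.eval_eq', MvPolynomial.eval_eq', Finset.mul_sum]
  refine Finset.sum_congr rfl fun α hα => ?_
  have h := hp (MvPolynomial.mem_support_iff.1 hα)
  rw [show Finsupp.weight (1 : Fin d → ℕ) α = α.degree from
    (DFunLike.congr_fun Finsupp.degree_eq_weight_one α).symm, Finsupp.degree_eq_sum] at h
  simp only [Pi.smul_apply, smul_eq_mul, mul_pow, Finset.prod_mul_distrib,
    Finset.prod_pow_eq_pow_sum, h]
  ring

lemma integral_pow_mul_exp_neg (N : ℕ) :
    ∫ r in Set.Ioi (0 : ℝ), r ^ N * Real.exp (-r) = N.factorial := by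
  rw [← Real.Gamma_nat_eq_factorial, Real.Gamma_eq_integral (by positivity)]
  refine setIntegral_congr_fun measurableSet_Ioi fun r hr => ?_
  simp [mul_comm]

lemma integrableOn_pow_mul_exp_neg (N : ℕ) :
    IntegrableOn (fun r : ℝ => r ^ N * Real.exp (-r)) (Set.Ioi 0) := by
  refine (Real.GammaIntegral_convergent (s := N + 1) (by positivity)).congr_fun
    (fun r hr => ?_) measurableSet_Ioi
  simp [mul_comm]

lemma integrable_eval_mul_exp {d : ℕ} (p : MvPolynomial (Fin d) ℂ) (c : ℝ) :
    Integrable (fun x : Fin d → ℂ => ‖MvPolynomial.eval x p‖ * Real.exp (c * ∑ j, ‖x j‖) *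
      Real.exp (-∑ j, ‖x j‖ ^ 2)) := by
  obtain ⟨C, c', hC, -, h⟩ := norm_eval_le_exp p
  have hp := (differentiable_eval p).continuous
  refine ((integrable_exp_sum_sub_sq (d := d) (c' + c)).const_mul C).mono' (by fun_prop)
    (.of_forall fun x => ?_)
  rw [Real.norm_of_nonneg (by positivity)]
  calc _ ≤ C * Real.exp (c' * ∑ j, ‖x j‖) * Real.exp (c * ∑ j, ‖x j‖) *
        Real.exp (-∑ j, ‖x j‖ ^ 2) := by gcongr; exact h x
    _ = _ := by
      rw [mul_assoc, mul_assoc, ← Real.exp_add, ← Real.exp_add]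
      ring_nf

lemma norm_sum_conj_mul_le {d : ℕ} (x z : Fin d → ℂ) :
    ‖∑ j, conj (x j) * z j‖ ≤ ‖z‖ * ∑ j, ‖x j‖ := by
  refine (norm_sum_le _ _).trans ?_
  rw [Finset.mul_sum]
  refine Finset.sum_le_sum fun j _ => ?_
  rw [norm_mul, RCLike.norm_conj, mul_comm]
  exact mul_le_mul_of_nonneg_right (norm_le_pi_norm z j) (norm_nonneg _)

/-- Against a bounded radial weight, a homogeneous polynomial times a conjugate kernel integrates to
a multiple of the polynomial. -/
lemma integral_radial_mul_eval_mul_cexp {d m : ℕ} (hd : 0 < d) {p : MvPolynomial (Fin d) ℂ}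
    (hp : p.IsHomogeneous m) (z : Fin d → ℂ) {g : ℝ → ℂ} (hg : Measurable g) {B : ℝ}
    (hB : ∀ r, ‖g r‖ ≤ B) :
    ∫ x : Fin d → ℂ, g (∑ j, ‖x j‖ ^ 2) *
      (MvPolynomial.eval x p * Complex.exp (∑ j, conj (x j) * z j) *
        (Real.exp (-∑ j, ‖x j‖ ^ 2) : ℂ)) =
      Real.pi ^ d * MvPolynomial.eval z p / (m + d - 1).factorial *
        ∫ r in Set.Ioi (0 : ℝ), g r * ((r ^ (m + d - 1) * Real.exp (-r) : ℝ) : ℂ) := by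
  have hpc := (differentiable_eval p).continuous
  set l : (Fin d → ℂ) → ℂ := fun x => ∑ j, conj (x j) * z j with hl
  have hlc : Continuous l := by fun_prop
  have hl1 : ∀ (u : ℂ) x, l (u • x) = conj u * l x := fun u x => by
    simp only [hl, Pi.smul_apply, smul_eq_mul, map_mul, Finset.mul_sum, mul_assoc]
  set F : (Fin d → ℂ) → ℂ := fun x => MvPolynomial.eval x p * (l x ^ m / m.factorial) with hF
  -- Under a positive real scaling `p` and `l ^ m` each contribute degree `m`.
  obtain ⟨C, hC⟩ := exists_integral_sumSq_mul_homogeneous hd (M := m) (F := F) fun s _ x => by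
    simp only [hF, eval_smul_of_isHomogeneous hp, hl1, Complex.conj_ofReal]
    ring
  have key : ∀ g : ℝ → ℂ, Measurable g → ∀ B : ℝ, (∀ r, ‖g r‖ ≤ B) →
      ∫ x : Fin d → ℂ, g (∑ j, ‖x j‖ ^ 2) *
        (MvPolynomial.eval x p * Complex.exp (l x) * (Real.exp (-∑ j, ‖x j‖ ^ 2) : ℂ)) =
      C * ∫ r in Set.Ioi (0 : ℝ), g r * ((r ^ (m + d - 1) * Real.exp (-r) : ℝ) : ℂ) := by
    intro g hg B hB
    have h := integral_mul_cexp_of_circle (E := Fin d → ℂ) (μ := volume)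
      (fun u hu f => integral_comp_smul_of_norm_eq_one hu f) m
      -- The radial factors are circle-invariant, so `G` is homogeneous of degree `m` under the
      -- circle. Boundedness of `g` supplies the domination.
      (G := fun x => g (∑ j, ‖x j‖ ^ 2) * (Real.exp (-∑ j, ‖x j‖ ^ 2) : ℂ) *
        MvPolynomial.eval x p) (l := l)
      (fun u hu x => by
        simp only [eval_smul_of_isHomogeneous hp, Pi.smul_apply, smul_eq_mul, norm_mul, hu, one_mul]
        ring)
      (fun u hu x => hl1 u x)
      (by
        refine Measurable.aestronglyMeasurable ?_
        have := hpc.measurable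
        fun_prop)
      (hlc.aestronglyMeasurable)
      (by
        refine ((integrable_eval_mul_exp p ‖z‖).const_mul B).mono' ?_ (.of_forall fun x => ?_)
        · refine Measurable.aestronglyMeasurable ?_
          have := hpc.measurable
          have := hlc.measurable
          fun_prop
        · have hB0 : 0 ≤ B := (norm_nonneg _).trans (hB 0)
          simp only [norm_mul, norm_norm, Complex.norm_real, Real.norm_of_nonneg (Real.exp_pos _).le]
          calc _ ≤ B * Real.exp (-∑ j, ‖x j‖ ^ 2) * ‖MvPolynomial.eval x p‖ *
                Real.exp (‖z‖ * ∑ j, ‖x j‖) := by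
                gcongr
                · exact hB _
                · exact norm_sum_conj_mul_le x z
            _ = _ := by ring)
    have h2 := hC fun r => g r * (Real.exp (-r) : ℂ)
    calc _ = _ := integral_congr_ae (.of_forall fun x => by ring)
      _ = _ := h
      _ = _ := integral_congr_ae (.of_forall fun x => by simp only [hF]; ring)
      _ = _ := h2
      _ = _ := by
        congr 1
        refine integral_congr_ae (.of_forall fun r => ?_)
        push_cast
        ring
  -- Weight one evaluates `C`: the left side is the reproducing property, the radial integral is a
  -- factorial.
  have h1 := key (fun _ => 1) measurable_const 1 (by simp)
  simp only [one_mul] at h1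
  rw [integral_complex_ofReal, integral_pow_mul_exp_neg, integral_eval_mul_cexp] at h1
  rw [key g hg B hB]
  congr 1
  have : ((m + d - 1).factorial : ℂ) ≠ 0 := by exact_mod_cast Nat.factorial_ne_zero _
  rw [eq_div_iff this, h1]
  norm_cast

/-! ### Integrals of product form -/

lemma integral_pi_succ {k : ℕ} {X : Fin (k + 1) → Type*} [∀ i, MeasurableSpace (X i)]
    (μ : ∀ i, Measure (X i)) [∀ i, SigmaFinite (μ i)] (f : (∀ i, X i) → ℂ) :
    ∫ x, f x ∂Measure.pi μ = ∫ p : X 0 × (∀ i : Fin k, X i.succ), f (Fin.cons p.1 p.2)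
      ∂(μ 0).prod (Measure.pi fun i => μ i.succ) := by
  rw [← (measurePreserving_piFinSuccAbove μ 0).symm.integral_comp' f]
  refine integral_congr_ae (.of_forall fun p => ?_)
  change f (Fin.insertNth 0 p.1 p.2) = _
  rw [Fin.insertNth_zero]
  rfl

/-- If for each factor the pairing of `F i` with functions of `S i` is given by the density `D i`,
then the same holds for the products. -/
lemma integral_comp_mul_prod {k : ℕ} {X : Fin k → Type*} [∀ i, MeasurableSpace (X i)]
    (μ : ∀ i, Measure (X i)) [∀ i, SigmaFinite (μ i)] {S : ∀ i, X i → ℝ}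
    (hS : ∀ i, Measurable (S i)) {F : ∀ i, X i → ℂ} (hF : ∀ i, Integrable (F i) (μ i))
    (ν : Fin k → Measure ℝ) [∀ i, SigmaFinite (ν i)] {D : Fin k → ℝ → ℂ}
    (hDm : ∀ i, Measurable (D i)) (hD : ∀ i, Integrable (D i) (ν i))
    (h : ∀ i (g : ℝ → ℂ) (B : ℝ), Measurable g → (∀ r, ‖g r‖ ≤ B) →
      ∫ x, g (S i x) * F i x ∂μ i = ∫ r, g r * D i r ∂ν i)
    {g : (Fin k → ℝ) → ℂ} (hg : Measurable g) {B : ℝ} (hB : ∀ r, ‖g r‖ ≤ B) :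
    ∫ x, g (fun i => S i (x i)) * ∏ i, F i (x i) ∂Measure.pi μ =
      ∫ r, g r * ∏ i, D i (r i) ∂Measure.pi ν := by
  induction k generalizing B with
  | zero =>
    rw [Measure.pi_of_empty _ (fun i => i.elim0), Measure.pi_of_empty _ (fun i => i.elim0),
      integral_dirac, integral_dirac]
    simp only [Finset.univ_eq_empty, Finset.prod_empty]
    congr 2
    funext i
    exact i.elim0
  | succ k ih =>
    rw [integral_pi_succ, integral_pi_succ]
    simp only [Fin.prod_univ_succ, Fin.cons_zero, Fin.cons_succ]
    have hcons : Measurable fun p : ℝ × (Fin k → ℝ) => (Fin.cons p.1 p.2 : Fin (k + 1) → ℝ) := by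
      refine measurable_pi_lambda _ fun i => ?_
      refine Fin.cases ?_ (fun j => ?_) i
      · exact measurable_fst
      · simpa [Function.comp_def] using (measurable_pi_apply j).comp measurable_snd
    have hgc : Measurable fun p : ℝ × (Fin k → ℝ) => g (Fin.cons p.1 p.2) := hg.comp hcons
    have hSt : Measurable fun x : (i : Fin k) → X i.succ => fun i => S i.succ (x i) :=
      measurable_pi_lambda _ fun i => (hS i.succ).comp (measurable_pi_apply i)
    have eS : ∀ (x : X 0) (y : (i : Fin k) → X i.succ),
        (fun i => S i ((Fin.cons x y : (i : Fin (k + 1)) → X i) i)) =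
          Fin.cons (S 0 x) fun i => S i.succ (y i) := fun x y => by
      funext i
      refine Fin.cases ?_ (fun j => ?_) i <;> simp
    -- Integrating out the first radial variable leaves a weight on the others that is again
    -- measurable and bounded, with a new bound; hence the induction generalizes `B`.
    have hg' : Measurable fun r' : Fin k → ℝ => ∫ r, g (Fin.cons r r') * D 0 r ∂ν 0 :=
      (StronglyMeasurable.integral_prod_left' (f := fun p : ℝ × (Fin k → ℝ) =>
        g (Fin.cons p.1 p.2) * D 0 p.1)
        (hgc.mul ((hDm 0).comp measurable_fst)).stronglyMeasurable).measurable
    have hB' : ∀ r' : Fin k → ℝ, ‖∫ r, g (Fin.cons r r') * D 0 r ∂ν 0‖ ≤ ∫ r, B * ‖D 0 r‖ ∂ν 0 :=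
      fun r' => norm_integral_le_of_norm_le ((hD 0).norm.const_mul B) (.of_forall fun r => by
        rw [norm_mul]
        exact mul_le_mul_of_nonneg_right (hB _) (norm_nonneg _))
    have key := ih (fun i => μ i.succ) (fun i => hS i.succ) (fun i => hF i.succ)
      (fun i => ν i.succ) (fun i => hDm i.succ) (fun i => hD i.succ) (fun i => h i.succ) hg' hB'
    -- The first factor is integrated innermost, with the other blocks frozen, so that `h 0`
    -- applies.
    rw [integral_prod_symm, integral_prod_symm]
    · calc _ = ∫ y, (∫ r, g (Fin.cons r fun i => S i.succ (y i)) * D 0 r ∂ν 0) *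
            ∏ i, F i.succ (y i) ∂Measure.pi fun i => μ i.succ := by
            refine integral_congr_ae (.of_forall fun y => ?_)
            simp only
            rw [← h 0 (fun r => g (Fin.cons r fun i => S i.succ (y i))) B
              (hgc.comp (measurable_id.prodMk measurable_const)) fun r => hB _,
              ← integral_mul_const]
            refine integral_congr_ae (.of_forall fun x => ?_)
            simp only [eS]
            ring
        _ = _ := key
        _ = _ := by
            refine integral_congr_ae (.of_forall fun y => ?_)
            simp only
            rw [← integral_mul_const]
            refine integral_congr_ae (.of_forall fun x => ?_)
            simp only
            ring
    · have i1 : Integrable (fun p : ℝ × (Fin k → ℝ) => D 0 p.1 * ∏ i, D (Fin.succ i) (p.2 i))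
          ((ν 0).prod (Measure.pi fun i => ν i.succ)) :=
        Integrable.mul_prod (f := D 0) (g := fun r : Fin k → ℝ => ∏ i, D (Fin.succ i) (r i)) (hD 0)
          (Integrable.fintype_prod_dep fun i => hD i.succ)
      exact Integrable.bdd_mul (f := fun p : ℝ × (Fin k → ℝ) => g (Fin.cons p.1 p.2)) (c := B) i1
        hgc.aestronglyMeasurable (.of_forall fun p => hB _)
    · have i1 : Integrable (fun p : X 0 × ((i : Fin k) → X i.succ) =>
            F 0 p.1 * ∏ i, F (Fin.succ i) (p.2 i))
          ((μ 0).prod (Measure.pi fun i => μ i.succ)) :=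
        Integrable.mul_prod (f := F 0)
          (g := fun r : (i : Fin k) → X i.succ => ∏ i, F (Fin.succ i) (r i)) (hF 0)
          (Integrable.fintype_prod_dep fun i => hF i.succ)
      simp only [eS]
      exact Integrable.bdd_mul (f := fun p : X 0 × ((i : Fin k) → X i.succ) =>
          g (Fin.cons (S 0 p.1) fun i => S i.succ (p.2 i))) (c := B) i1
        (hgc.comp (((hS 0).comp measurable_fst).prodMk
          (hSt.comp measurable_snd))).aestronglyMeasurable (.of_forall fun p => hB _)

/-! ### Passing from the symbol to its radial profile -/

variable {k : ℕ} {n : Fin k → ℕ}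

/-- The squared Euclidean norms of the blocks of `z`. -/
noncomputable def blockSq (z : Cn n) : Fin k → ℝ := fun i => ∑ j, ‖z i j‖ ^ 2

/-- Scaling the `i`-th block by `√(s i)`. -/
noncomputable def blockScale (s : Fin k → ℝ) (z : Cn n) : Cn n :=
  fun i j => ((Real.sqrt (s i) : ℝ) : ℂ) * z i j

lemma continuous_blockSq : Continuous (blockSq (n := n)) := by unfold blockSq; fun_prop

lemma continuous_blockScale :
    Continuous fun p : (Fin k → ℝ) × Cn n => blockScale p.1 p.2 := by
  unfold blockScale; fun_prop

lemma blockSq_blockScale {s : Fin k → ℝ} (hs : s ∈ orthant k) (z : Cn n) :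
    blockSq (blockScale s z) = s * blockSq z := by
  funext i
  simp only [blockSq, blockScale, norm_mul, Complex.norm_real, mul_pow, Real.norm_eq_abs, sq_abs,
    Real.sq_sqrt (hs i (Set.mem_univ i)).le, Pi.mul_apply, Finset.mul_sum]

lemma blockNorms_eq_sqrt_blockSq (z : Cn n) :
    blockNorms z = fun i => Real.sqrt (blockSq z i) := rfl

lemma blockSq_mem_orthant {z : Cn n} (hz : ∀ i, z i ≠ 0) : blockSq z ∈ orthant k := by
  refine fun i _ => ?_
  obtain ⟨j, hj⟩ := Function.ne_iff.1 (hz i)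
  have hj' : 0 < ‖z i j‖ ^ 2 := by
    have := norm_pos_iff.2 hj
    positivity
  exact hj'.trans_le (Finset.single_le_sum (f := fun j => ‖z i j‖ ^ 2) (fun _ _ => by positivity)
    (Finset.mem_univ j))

lemma isOpen_orthant : IsOpen (orthant k) :=
  isOpen_set_pi Set.finite_univ fun _ _ => isOpen_Ioi

lemma measurableSet_orthant : MeasurableSet (orthant k) := isOpen_orthant.measurableSet

lemma volume_restrict_orthant_ne_zero : (volume.restrict (orthant k)) ≠ 0 := by
  rw [Ne, Measure.restrict_eq_zero]
  exact (isOpen_orthant.measure_pos _ ⟨fun _ => 1, fun i _ => by simp⟩).ne'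

lemma quasiMeasurePreserving_of_injective {E : Type*} [NormedAddCommGroup E] [NormedSpace ℝ E]
    [FiniteDimensional ℝ E] [MeasurableSpace E] [BorelSpace E] (μ : Measure E)
    [μ.IsAddHaarMeasure] (f : E →ₗ[ℝ] E) (hf : Function.Injective f) :
    Measure.QuasiMeasurePreserving f μ μ :=
  Measure.LinearMap.quasiMeasurePreserving μ f fun h0 =>
    (LinearMap.bot_lt_ker_of_det_eq_zero h0).ne' (LinearMap.ker_eq_bot.2 hf)

lemma quasiMeasurePreserving_blockScale {s : Fin k → ℝ} (hs : s ∈ orthant k) :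
    Measure.QuasiMeasurePreserving (blockScale (n := n) s) := by
  let f : Cn n →ₗ[ℝ] Cn n :=
    { toFun := blockScale s
      map_add' := fun x y => by ext i j; simp [blockScale, mul_add]
      map_smul' := fun c x => by ext i j; simp [blockScale]; ring }
  refine quasiMeasurePreserving_of_injective volume f fun x y h => ?_
  ext i j
  have h1 := congrFun (congrFun h i) j
  have h2 : ((Real.sqrt (s i) : ℝ) : ℂ) ≠ 0 := by
    exact_mod_cast (Real.sqrt_pos.2 (hs i (Set.mem_univ i))).ne'
  exact mul_left_cancel₀ h2 h1

lemma quasiMeasurePreserving_mul_orthant {c : Fin k → ℝ} (hc : c ∈ orthant k) :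
    Measure.QuasiMeasurePreserving (fun r : Fin k → ℝ => r * c)
      (volume.restrict (orthant k)) (volume.restrict (orthant k)) := by
  have h := quasiMeasurePreserving_of_injective (volume : Measure (Fin k → ℝ))
    (LinearMap.mulRight ℝ c) fun x y h => by
      funext i
      exact mul_right_cancel₀ (hc i (Set.mem_univ i)).ne' (congrFun h i)
  exact h.restrict fun r hr i hi => mul_pos (Set.mem_Ioi.1 (hr i hi)) (Set.mem_Ioi.1 (hc i hi))

lemma inv_mem_orthant {c : Fin k → ℝ} (hc : c ∈ orthant k) : c⁻¹ ∈ orthant k :=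
  fun i hi => inv_pos.2 (Set.mem_Ioi.1 (hc i hi))

lemma mul_inv_cancel_of_mem_orthant {c : Fin k → ℝ} (hc : c ∈ orthant k) : c⁻¹ * c = 1 := by
  funext i
  exact inv_mul_cancel₀ (hc i (Set.mem_univ i)).ne'

lemma ae_blockSq_mem_orthant (hn : ∀ i, 0 < n i) : ∀ᵐ z : Cn n, blockSq z ∈ orthant k := by
  have h : ∀ᵐ z : Cn n, ∀ i, z i ≠ 0 := by
    refine ae_all_iff.2 fun i => ?_
    have : Nonempty (Fin (n i)) := ⟨⟨0, hn i⟩⟩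
    have h0 : ∀ᵐ x : Fin (n i) → ℂ, x ≠ 0 := by simp [ae_iff]
    exact (Measure.quasiMeasurePreserving_eval
      (fun i => (volume : Measure (Fin (n i) → ℂ))) i).ae h0
  filter_upwards [h] with z hz using blockSq_mem_orthant hz

/-- Exchanging two almost-everywhere quantifiers requires a measurable set, which an arbitrary
predicate does not provide. -/
lemma exists_measurableSet_of_ae {X : Type*} [MeasurableSpace X] {μ : Measure X} {p : X → Prop}
    (h : ∀ᵐ x ∂μ, p x) : ∃ t, MeasurableSet t ∧ (∀ᵐ x ∂μ, x ∈ t) ∧ ∀ x ∈ t, p x := by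
  obtain ⟨t, hpt, ht, h0⟩ := exists_measurable_superset_of_null (ae_iff.1 h)
  refine ⟨tᶜ, ht.compl, ?_, fun x hx => by_contra fun hp => hx (hpt hp)⟩
  rw [ae_iff]
  simpa using h0

/-- Each fixed scaling by a point of the orthant preserves null sets; Fubini then exchanges `s` and
`z`. -/
lemma ae_ae_blockScale {p : Cn n → Prop} (h : ∀ᵐ z, p z) :
    ∀ᵐ z : Cn n, ∀ᵐ s ∂(volume.restrict (orthant k)), p (blockScale s z) := by
  obtain ⟨t, ht, hae, hp⟩ := exists_measurableSet_of_ae h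
  have h1 : ∀ᵐ s ∂(volume.restrict (orthant k)), ∀ᵐ z : Cn n, blockScale s z ∈ t := by
    filter_upwards [ae_restrict_mem measurableSet_orthant] with s hs
    exact (quasiMeasurePreserving_blockScale hs).ae hae
  rw [Measure.ae_ae_comm (p := fun s z => blockScale s z ∈ t)
    (continuous_blockScale.measurable ht)] at h1
  filter_upwards [h1] with z hz
  filter_upwards [hz] with s hs using hp _ hs

/-- A property holding almost everywhere on the orthant holds at the squared block norms of almost
every point. -/
lemma ae_blockSq (hn : ∀ i, 0 < n i) {p : (Fin k → ℝ) → Prop}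
    (h : ∀ᵐ r ∂(volume.restrict (orthant k)), p r) : ∀ᵐ z : Cn n, p (blockSq z) := by
  obtain ⟨t, ht, hae, hp⟩ := exists_measurableSet_of_ae h
  have h1 : ∀ᵐ z : Cn n, ∀ᵐ s ∂(volume.restrict (orthant k)), s * blockSq z ∈ t := by
    filter_upwards [ae_blockSq_mem_orthant hn] with z hz
    exact (quasiMeasurePreserving_mul_orthant hz).ae hae
  have hm : Measurable fun q : Cn n × (Fin k → ℝ) => q.2 * blockSq q.1 :=
    measurable_snd.mul (continuous_blockSq.measurable.comp measurable_fst)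
  rw [Measure.ae_ae_comm (p := fun z s => s * blockSq z ∈ t) (hm ht)] at h1
  have := ae_neBot.2 (volume_restrict_orthant_ne_zero (k := k))
  -- One good scale `s` suffices: the property holds at `s * blockSq z` for almost every `z`, and
  -- replacing `z` by its scaling with `s⁻¹` removes the factor `s`.
  obtain ⟨s, hs, hso⟩ := (h1.and (ae_restrict_mem measurableSet_orthant)).exists
  filter_upwards [(quasiMeasurePreserving_blockScale (n := n) (inv_mem_orthant hso)).ae hs] with z hz
  rw [blockSq_blockScale (inv_mem_orthant hso), ← mul_assoc, mul_comm s,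
    mul_inv_cancel_of_mem_orthant hso, one_mul] at hz
  exact hp _ hz

lemma exists_bounded_measurable_ae_eq {X : Type*} [MeasurableSpace X] {μ : Measure X} {f : X → ℂ}
    (hf : MemLp f ∞ μ) : ∃ (g : X → ℂ) (B : ℝ), Measurable g ∧ (∀ x, ‖g x‖ ≤ B) ∧ f =ᵐ[μ] g := by
  have hfin := hf.2
  rw [eLpNorm_exponent_top] at hfin
  set B := (eLpNormEssSup f μ).toReal
  set g := hf.1.mk f with hgdef
  have hg : Measurable g := hf.1.stronglyMeasurable_mk.measurable
  have hset : MeasurableSet {x | ‖g x‖ ≤ B} := measurableSet_le hg.norm measurable_const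
  -- Truncation at the essential supremum makes the bound hold everywhere.
  refine ⟨{x | ‖g x‖ ≤ B}.indicator g, B, hg.indicator hset, fun x => ?_, ?_⟩
  · by_cases hx : ‖g x‖ ≤ B
    · rwa [Set.indicator_of_mem (by exact hx)]
    · rw [Set.indicator_of_notMem (by exact hx), norm_zero]
      exact ENNReal.toReal_nonneg
  · filter_upwards [hf.1.ae_eq_mk, ae_le_eLpNormEssSup (f := f) (μ := μ)] with x hx hle
    have : ‖g x‖ ≤ B := by
      rw [hgdef, ← hx]
      have := ENNReal.toReal_mono hfin.ne hle
      rwa [toReal_enorm] at this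
    rw [Set.indicator_of_mem (by exact this)]
    exact hx

/-- The radial profile of a bounded symbol agrees almost everywhere with a bounded measurable
function. -/
lemma exists_measurable_profile (hn : ∀ i, 0 < n i) {φ : Cn n → ℂ} (hφ : MemLp φ ∞ volume)
    {a : (Fin k → ℝ) → ℂ} (ha : ∀ z, φ z = a (blockNorms z)) :
    ∃ (b : (Fin k → ℝ) → ℂ) (B : ℝ), Measurable b ∧ (∀ r, ‖b r‖ ≤ B) ∧
      (∀ᵐ r ∂(volume.restrict (orthant k)), a (fun i => Real.sqrt (r i)) = b r) ∧
      ∀ᵐ z, φ z = b (blockSq z) := by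
  obtain ⟨ψ, B, hψ, hB, hφψ⟩ := exists_bounded_measurable_ae_eq hφ
  -- A generic point `z` with nonzero blocks, almost all of whose scalings satisfy `φ = ψ`. Scaling
  -- it by `r * (blockSq z)⁻¹` reaches squared block norms `r`, so `ψ` along these scalings is a
  -- Borel version of the profile.
  obtain ⟨z, hz, hzo⟩ := ((ae_ae_blockScale hφψ).and (ae_blockSq_mem_orthant hn)).exists
  have hzi := inv_mem_orthant hzo
  have hb : ∀ᵐ r ∂(volume.restrict (orthant k)), a (fun i => Real.sqrt (r i)) =
      ψ (blockScale (r * (blockSq z)⁻¹) z) := by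
    filter_upwards [(quasiMeasurePreserving_mul_orthant hzi).ae hz,
      ae_restrict_mem measurableSet_orthant] with r hr hro
    have hm : r * (blockSq z)⁻¹ ∈ orthant k := fun i hi =>
      mul_pos (Set.mem_Ioi.1 (hro i hi)) (Set.mem_Ioi.1 (hzi i hi))
    rw [← hr, ha, blockNorms_eq_sqrt_blockSq, blockSq_blockScale hm, mul_assoc,
      mul_inv_cancel_of_mem_orthant hzo, mul_one]
  refine ⟨fun r => ψ (blockScale (r * (blockSq z)⁻¹) z), B, ?_, fun r => hB _, hb, ?_⟩
  · exact hψ.comp (continuous_blockScale.measurable.comp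
      ((measurable_id.mul_const _).prodMk measurable_const))
  · filter_upwards [ae_blockSq hn hb] with w hw
    rw [ha, blockNorms_eq_sqrt_blockSq, hw]

/-! ### The action on polynomials -/

lemma restrict_orthant_eq_pi : (volume : Measure (Fin k → ℝ)).restrict (orthant k) =
    Measure.pi fun _ => volume.restrict (Set.Ioi (0 : ℝ)) := by
  rw [orthant, volume_pi, Measure.restrict_pi_pi]

lemma integrable_eval_mul_cexp {d : ℕ} (p : MvPolynomial (Fin d) ℂ) (z : Fin d → ℂ) :
    Integrable (fun x : Fin d → ℂ => MvPolynomial.eval x p *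
      Complex.exp (∑ j, conj (x j) * z j) * (Real.exp (-∑ j, ‖x j‖ ^ 2) : ℂ)) := by
  have hp := (differentiable_eval p).continuous
  refine (integrable_eval_mul_exp p ‖z‖).mono' (by fun_prop) (.of_forall fun x => ?_)
  simp only [norm_mul, Complex.norm_real, Real.norm_of_nonneg (Real.exp_pos _).le]
  gcongr
  rw [Complex.norm_exp]
  exact Real.exp_le_exp.2 ((Complex.re_le_norm _).trans (norm_sum_conj_mul_le x z))

lemma integral_gaussian (f : Cn n → ℂ) : ∫ w, f w ∂gaussian n =
    ((Real.pi : ℂ) ^ ∑ i, n i)⁻¹ * ∫ w, (Real.exp (-normSq w) : ℂ) * f w := by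
  have hm : Measurable fun z : Cn n =>
      ENNReal.ofReal ((Real.pi ^ (∑ i, n i))⁻¹ * Real.exp (-normSq z)) :=
    (ENNReal.continuous_ofReal.comp (by have := continuous_normSq (n := n); fun_prop)).measurable
  rw [gaussian, integral_withDensity_eq_integral_toReal_smul hm
    (.of_forall fun _ => ENNReal.ofReal_lt_top), ← integral_const_mul]
  refine integral_congr_ae (.of_forall fun w => ?_)
  simp only
  rw [ENNReal.toReal_ofReal (by positivity), Complex.real_smul]
  push_cast
  ring

lemma integrable_pow_mul_exp_orthant (N : Fin k → ℕ) :
    Integrable (fun r : Fin k → ℝ => (((∏ i, r i ^ N i) * Real.exp (-∑ i, r i) : ℝ) : ℂ))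
      (volume.restrict (orthant k)) := by
  rw [restrict_orthant_eq_pi]
  have h : Integrable (fun r : Fin k → ℝ => ∏ i, (r i ^ N i * Real.exp (-r i)))
      (Measure.pi fun _ => volume.restrict (Set.Ioi (0 : ℝ))) :=
    Integrable.fintype_prod (f := fun i (r : ℝ) => r ^ N i * Real.exp (-r))
      fun i => integrableOn_pow_mul_exp_neg (N i)
  refine h.ofReal.congr (.of_forall fun r => ?_)
  simp only [Finset.prod_mul_distrib, ← Real.exp_sum, Finset.sum_neg_distrib]
  rfl

lemma integrableOn_gammaIntegrand (hn : ∀ i, 0 < n i) {φ : Cn n → ℂ} (hφ : MemLp φ ∞ volume)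
    {a : (Fin k → ℝ) → ℂ} (ha : ∀ z, φ z = a (blockNorms z)) (m : Fin k → ℕ) :
    IntegrableOn (gammaIntegrand n a m) (orthant k) := by
  obtain ⟨b, B, hb, hB, hab, -⟩ := exists_measurable_profile hn hφ ha
  refine ((integrable_pow_mul_exp_orthant fun i => m i + n i - 1).bdd_mul (f := b) (c := B)
    hb.aestronglyMeasurable (.of_forall hB)).congr ?_
  filter_upwards [hab] with r hr
  rw [gammaIntegrand, hr]

lemma bergman_symbol_mul_prod_eval (hn : ∀ i, 0 < n i) {φ : Cn n → ℂ} (hφ : MemLp φ ∞ volume)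
    {a : (Fin k → ℝ) → ℂ} (ha : ∀ z, φ z = a (blockNorms z)) {m : Fin k → ℕ}
    {p : (i : Fin k) → MvPolynomial (Fin (n i)) ℂ} (hp : ∀ i, (p i).IsHomogeneous (m i))
    (z : Cn n) :
    bergman (fun w => φ w * ∏ i, MvPolynomial.eval (w i) (p i)) z =
      gamma n a m * ∏ i, MvPolynomial.eval (z i) (p i) := by
  obtain ⟨b, B, hb, hB, hab, hφb⟩ := exists_measurable_profile hn hφ ha
  -- The one-block constants. In their product the powers of `π` cancel the Gaussian normalization,
  -- and the factorials form the prefactor of `gamma`.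
  set K : Fin k → ℂ := fun i =>
    Real.pi ^ n i * MvPolynomial.eval (z i) (p i) / (m i + n i - 1).factorial with hK
  have key := integral_comp_mul_prod (X := fun i => Fin (n i) → ℂ) (fun _ => volume)
    (S := fun i x => ∑ j, ‖x j‖ ^ 2) (fun i => by fun_prop)
    (F := fun i x => MvPolynomial.eval x (p i) * Complex.exp (∑ j, conj (x j) * z i j) *
      (Real.exp (-∑ j, ‖x j‖ ^ 2) : ℂ)) (fun i => integrable_eval_mul_cexp (p i) (z i))
    (fun _ => volume.restrict (Set.Ioi (0 : ℝ)))
    (D := fun i r => K i * ((r ^ (m i + n i - 1) * Real.exp (-r) : ℝ) : ℂ))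
    (fun i => by fun_prop)
    (fun i => (integrableOn_pow_mul_exp_neg (m i + n i - 1)).ofReal.const_mul (K i))
    (fun i g B hg hB => by
      rw [integral_radial_mul_eval_mul_cexp (hn i) (hp i) (z i) hg hB, ← integral_const_mul]
      exact integral_congr_ae (.of_forall fun r => by simp only [hK]; ring))
    hb hB
  rw [← restrict_orthant_eq_pi] at key
  have e1 : ∫ w : Cn n, (Real.exp (-normSq w) : ℂ) *
      (φ w * (∏ i, MvPolynomial.eval (w i) (p i)) * conj (kernel z w)) =
      ∫ w : Cn n, b (fun i => ∑ j, ‖w i j‖ ^ 2) * ∏ i, (MvPolynomial.eval (w i) (p i) *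
        Complex.exp (∑ j, conj (w i j) * z i j) * (Real.exp (-∑ j, ‖w i j‖ ^ 2) : ℂ)) := by
    refine integral_congr_ae ?_
    filter_upwards [hφb] with w hw
    rw [hw, conj_kernel, pairing_apply, Finset.prod_mul_distrib, Finset.prod_mul_distrib,
      ← Complex.exp_sum, ← Complex.ofReal_prod, ← Real.exp_sum, Finset.sum_neg_distrib, normSq]
    change _ * (b (fun i => ∑ j, ‖w i j‖ ^ 2) * _ * _) = _
    ring
  have e2 : ∫ r in orthant k, b r * ∏ i, (K i * ((r i ^ (m i + n i - 1) * Real.exp (-r i) : ℝ) : ℂ))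
      = (∏ i, K i) * ∫ r in orthant k, gammaIntegrand n a m r := by
    rw [← integral_const_mul]
    refine integral_congr_ae ?_
    filter_upwards [hab] with r hr
    rw [gammaIntegrand, hr, Finset.prod_mul_distrib, ← Complex.ofReal_prod,
      Finset.prod_mul_distrib, ← Real.exp_sum, Finset.sum_neg_distrib]
    ring
  have e3 : ∏ i, K i = Real.pi ^ (∑ i, n i) * (∏ i, MvPolynomial.eval (z i) (p i)) /
      ((∏ i, (m i + n i - 1).factorial : ℕ) : ℂ) := by
    simp only [hK, Finset.prod_div_distrib, Finset.prod_mul_distrib, Finset.prod_pow_eq_pow_sum,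
      Nat.cast_prod]
  have hpi : (Real.pi : ℂ) ≠ 0 := by exact_mod_cast Real.pi_ne_zero
  rw [bergman, integral_gaussian, e1]
  refine (congrArg _ (key.trans e2)).trans ?_
  rw [e3, gamma]
  field_simp

lemma bergman_symbol_mul (hn : ∀ i, 0 < n i) {φ : Cn n → ℂ} (hφ : MemLp φ ∞ volume)
    {a : (Fin k → ℝ) → ℂ} (ha : ∀ z, φ z = a (blockNorms z)) {m : Fin k → ℕ} {f : Cn n → ℂ}
    (hf : f ∈ homPoly n m) (z : Cn n) :
    bergman (fun w => φ w * f w) z = gamma n a m * f z := by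
  induction hf using Submodule.span_induction with
  | mem f hf =>
    obtain ⟨p, hp, rfl⟩ := hf
    exact bergman_symbol_mul_prod_eval hn hφ ha hp z
  | zero => simp [bergman]
  | add f g hf hg ihf ihg =>
    -- Linearity of `toeplitz` already contains the integrability needed to split the integral.
    have h := map_add (toeplitz φ hφ) ⟨f, homPoly_le_fock n m hf⟩ ⟨g, homPoly_le_fock n m hg⟩
    refine (congrFun (congrArg Subtype.val h) z).trans ?_
    change bergman (fun w => φ w * f w) z + bergman (fun w => φ w * g w) z = _
    rw [ihf, ihg, Pi.add_apply, mul_add]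
  | smul c f hf ihf =>
    have h := map_smul (toeplitz φ hφ) c ⟨f, homPoly_le_fock n m hf⟩
    refine (congrFun (congrArg Subtype.val h) z).trans ?_
    change c * bergman (fun w => φ w * f w) z = _
    rw [ihf, Pi.smul_apply, smul_eq_mul]
    ring

/-- Both the exponents and the factorials depend on `m` and `n` only through `m i + n i - 1`. -/
lemma gamma_eq_gamma_one (n : Fin k → ℕ) (a : (Fin k → ℝ) → ℂ) (m : Fin k → ℕ) :
    gamma n a m = gamma (fun _ => 1) a (fun i => m i + n i - 1) := by
  simp only [gamma, gammaIntegrand, Nat.add_sub_cancel]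

end QuasiRadial

theorem theorem2p6 {k : ℕ} (n : Fin k → ℕ) (hn : ∀ i, 0 < n i)
    (φ : QuasiRadial.Cn n → ℂ) (hφ : QuasiRadial.IsQuasiRadialSymbol φ) :
    (∃ a : (Fin k → ℝ) → ℂ, ∀ z, φ z = a (QuasiRadial.blockNorms z)) ∧
    ∀ a : (Fin k → ℝ) → ℂ, (∀ z, φ z = a (QuasiRadial.blockNorms z)) →
      ∀ m : Fin k → ℕ,
        QuasiRadial.homPoly n m ≤ QuasiRadial.fock n ∧
        (∀ f : QuasiRadial.fock n, (f : QuasiRadial.Cn n → ℂ) ∈ QuasiRadial.homPoly n m →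
          QuasiRadial.toeplitz φ hφ.memLp f = QuasiRadial.gamma n a m • f) ∧
        IntegrableOn (QuasiRadial.gammaIntegrand n a m) (QuasiRadial.orthant k) ∧
        QuasiRadial.gamma n a m =
          QuasiRadial.gamma (fun _ => 1) a (fun i => m i + n i - 1) := by
  refine ⟨QuasiRadial.exists_eq_comp_blockNorms hφ, fun a ha m =>
    ⟨QuasiRadial.homPoly_le_fock n m, fun f hf => ?_,
      QuasiRadial.integrableOn_gammaIntegrand hn hφ.memLp ha m,
      QuasiRadial.gamma_eq_gamma_one n a m⟩⟩
  ext z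
  exact QuasiRadial.bergman_symbol_mul hn hφ.memLp ha hf z
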